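/- Let $X$ be a standard Borel space and let $q \ge 1$ be an integer, identified with the set $\{0,\dots,q-1\}$. An $(X,q)$-constraint with finite domain $D \subseteq X$ is a set $B \subseteq q^D$ of functions $D \to q$; we write $\mathrm{dom}(B) = D$. (The empty constraint $B=\varnothing$ is regarded as a single constraint, with domain $\varnothing$.) Thus a constraint is a finite set of finite partial functions from $X$ to $q$ that all have the same domain. A function $f\colon X\to q$ violates $B$ if $f|_{\mathrm{dom}(B)} \in B$, and satisfies $B$ otherwise. A constraint satisfaction problem (CSP) $\mathscr B\colon X \to^? q$ is a set of $(X,q)$-constraints, and a solution to $\mathscr B$ is a function $f \colon X \to q$ that satisfies every $B \in \mathscr B$. For a standard Borel space $Y$, the set $[Y]^{<\infty}$ of finite subsets of $Y$ carries the standard Borel structure of the disjoint union over $k \in \mathbb N$ of the sets $[Y]^k$ of $k$-element subsets, where $[Y]^k$ is the quotient of the space of $k$-tuples of distinct points of $Y$ by the relation of enumerating the same set. Identifying finite partial functions from $X$ to $q$ with their graphs, which are finite subsets of $X \times q$, and constraints with finite sets of such functions, the set $\mathsf{Const}(X,q)$ of all $(X,q)$-constraints inherits a standard Borel structure. The CSP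 $\mathscr B$ is Borel if it is a Borel subset of $\mathsf{Const}(X,q)$. Put $$\mathbb P[B] = \frac{|B|}{q^{|\mathrm{dom}(B)|}},\qquad \mathsf p(\mathscr B) = \sup_{B\in\mathscr B}\mathbb P[B],\qquad \mathsf d(\mathscr B) = \sup_{B\in\mathscr B} \bigl|\{B'\in\mathscr B : B'\ne B,\ \mathrm{dom}(B')\cap\mathrm{dom}(B)\neq\varnothing\}\bigr| \in \mathbb N\cup\{\infty\},$$ where the suprema are $0$ if $\mathscr B = \varnothing$. **Corollary.** Let $\mathscr B\colon X\to^? q$ be a Borel CSP on a standard Borel space $X$ such that $$\mathsf p(\mathscr B)\,(\mathsf d(\mathscr B)+1)^2 \le e^{-2}.$$ If $\tau$ is a compatible Polish topology on $X$ (a Polish topology whose Borel $\sigma$-algebra is the given one), then $\mathscr B$ has a $\tau$-Baire-measurable solution, i.e. a solution $f\colon X\to q$ such that for every $i<q$ the set $f^{-1}(i)$ has the Baire property with respect to $\tau$ (it differs from a $\tau$-open set by a $\tau$-meager set). -/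

import Mathlib

open scoped ENNReal

namespace BorelCSP

/-- The Borel structure on the space `[X]^{<∞}` of finite subsets of a standard Borel space `X`:
the disjoint union, over `k ∈ ℕ`, of the quotients `[X]^k` of the space of injective `k`-tuples of
points of `X`, two tuples being identified when they enumerate the same set. Explicitly, a family
`𝒜` of finite sets is Borel iff for each `k` the set of injective `k`-tuples that enumerate a member
of `𝒜` is Borel. (This is not Mathlib's instance on `Finset X`, which is pulled back from the
product `σ`-algebra on `X → Prop` and ignores the Borel structure of `X`.) -/
abbrev finsetBorel (X : Type*) [MeasurableSpace X] : MeasurableSpace (Finset X) :=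
  ⨅ k : ℕ, MeasurableSpace.map
    (fun x : {x : Fin k → X // Function.Injective x} =>
      (Finset.univ : Finset (Fin k)).map ⟨x.1, x.2⟩)
    inferInstance

/-- `[X → q]^{<∞}`: the partial functions from `X` to `q = {0, …, q - 1}` with finite domain,
identified with their graphs. -/
@[ext]
structure FinFun (X : Type*) (q : ℕ) where
  graph : Finset (X × Fin q)
  functional : ∀ a ∈ graph, ∀ b ∈ graph, a.1 = b.1 → a = b

/-- The Borel structure induced from the finite subsets of `X × q`. -/
instance (X : Type*) [MeasurableSpace X] (q : ℕ) : MeasurableSpace (FinFun X q) :=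
  (finsetBorel (X × Fin q)).comap FinFun.graph

/-- The domain of a finite partial function. -/
noncomputable def FinFun.dom {X : Type*} {q : ℕ} (φ : FinFun X q) : Finset X :=
  open Classical in φ.graph.image Prod.fst

/-- The restriction of a coloring `f : X → q` to a finite set `D`. -/
def restrict {X : Type*} {q : ℕ} (f : X → Fin q) (D : Finset X) : FinFun X q where
  graph := D.map ⟨fun x => (x, f x), Function.LeftInverse.injective (g := Prod.fst) fun _ => rfl⟩
  functional := by
    intro a ha b hb hab
    obtain ⟨x, -, rfl⟩ := Finset.mem_map.1 ha
    obtain ⟨y, -, rfl⟩ := Finset.mem_map.1 hb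
    have h : x = y := hab
    rw [h]

/-- `Const(X, q)`: the `(X, q)`-constraints, i.e. the finite sets of finite partial functions
`X ⇀ q` all of which have the same domain. -/
@[ext]
structure Constraint (X : Type*) (q : ℕ) where
  patterns : Finset (FinFun X q)
  dom_eq : ∀ φ ∈ patterns, ∀ ψ ∈ patterns, φ.dom = ψ.dom

/-- The Borel structure induced from the finite subsets of `FinFun X q`. -/
instance (X : Type*) [MeasurableSpace X] (q : ℕ) : MeasurableSpace (Constraint X q) :=
  (finsetBorel (FinFun X q)).comap Constraint.patterns

/-- The domain of a constraint: the common domain of its members. (The empty constraint has no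
member; its domain is `∅`.) -/
noncomputable def Constraint.dom {X : Type*} {q : ℕ} (B : Constraint X q) : Finset X :=
  open Classical in B.patterns.biUnion FinFun.dom

/-- `f` violates `B` if the restriction of `f` to `dom B` belongs to `B`. -/
def Constraint.Violates {X : Type*} {q : ℕ} (f : X → Fin q) (B : Constraint X q) : Prop :=
  restrict f B.dom ∈ B.patterns

/-- The probability `|B| / q ^ |dom B|` of a constraint. -/
noncomputable def Constraint.prob {X : Type*} {q : ℕ} (B : Constraint X q) : ℝ≥0∞ :=
  (B.patterns.card : ℝ≥0∞) / (q : ℝ≥0∞) ^ B.dom.card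

/-- A constraint satisfaction problem on `X` with range `q` is a set of `(X, q)`-constraints. -/
abbrev CSP (X : Type*) (q : ℕ) : Type _ := Set (Constraint X q)

/-- A CSP is Borel if it is a Borel subset of the space of constraints. -/
def CSP.IsBorel {X : Type*} [MeasurableSpace X] {q : ℕ} (𝓑 : CSP X q) : Prop :=
  MeasurableSet 𝓑

/-- A solution satisfies, that is, does not violate, every constraint. -/
def CSP.IsSolution {X : Type*} {q : ℕ} (𝓑 : CSP X q) (f : X → Fin q) : Prop :=
  ∀ B ∈ 𝓑, ¬ B.Violates f

/-- `p(𝓑)`: the supremum of the probabilities of the constraints (`0` if there are none). -/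
noncomputable def CSP.p {X : Type*} {q : ℕ} (𝓑 : CSP X q) : ℝ≥0∞ :=
  ⨆ B ∈ 𝓑, B.prob

/-- `d(𝓑)`: the supremum over `B ∈ 𝓑` of the number of the other constraints in `𝓑` whose domain
meets that of `B`; it may be infinite. -/
noncomputable def CSP.d {X : Type*} {q : ℕ} (𝓑 : CSP X q) : ℕ∞ :=
  ⨆ B ∈ 𝓑, {B' | B' ∈ 𝓑 ∧ B ≠ B' ∧ ∃ x, x ∈ B'.dom ∧ x ∈ B.dom}.encard

end BorelCSP

/-! Call two points adjacent if one constraint involves both. When `d` is infinite the hypothesis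
forces `p = 0` and every function is a solution, so let `d` be finite and put θ = 1/(e(d+1)); every
constraint then has probability at most θ².

Suppose first that the space splits into `U` and `Uᶜ`, each with finite components for adjacency.
Colour `U`, one component at a time, so that every constraint keeps conditional probability below θ.
By Markov's inequality this fails for a given constraint with probability at most θ, and eθ(d+1) ≤ 1
is what the finite symmetric local lemma asks for. Then colour `Uᶜ`: failure now means conditional
probability at least 1, and again has probability at most θ. The two rounds account for the square
in the hypothesis. Each component is finite, so the choices become Borel by taking the first success
in a countable family of Borel functions that interpolates every function on every finite set
(`IsBoundedBorel.exists_round`).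

Such a Borel `U` is found on a comeager Borel invariant set (`exists_finComp_partition`). It grows
in countably many stages; each adds finite boundaries around non-meagerly many points of a
prescribed kind, never next to points added earlier (`exists_enclosing_step`). Components of `U`
then stop growing, and generic points are enclosed by `U`. On the remaining invariant meager set,
the axiom of choice gives a partition by parity of the distance to a root (`exists_finComp_parity`).
No constraint with a nonempty domain straddles the two sets, so the two colourings glue together.

Borelness survives the quantifiers over finite neighbourhoods because the relations involved are
countable unions of Borel graphs (`Tame`). For adjacency this is the Lusin–Novikov theorem for
bounded fibres, which needs little more than Lusin–Souslin. -/

namespace BorelCSP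

/-! ### Relations covered by countably many Borel graphs -/

/-- A relation with countable sections that is the union of countably many graphs of Borel
functions with Borel domains. -/
def Tame {X Y : Type*} [MeasurableSpace X] [MeasurableSpace Y] (R : X → Y → Prop) : Prop :=
  ∃ (ι : Type) (_ : Countable ι) (D : ι → Set X) (h : ι → X → Y),
    (∀ i, MeasurableSet (D i)) ∧ (∀ i, Measurable (h i)) ∧
      ∀ x y, R x y ↔ ∃ i, x ∈ D i ∧ h i x = y

namespace Tame

variable {X Y Z Ω : Type*} [MeasurableSpace X] [MeasurableSpace Y] [MeasurableSpace Z]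
  [MeasurableSpace Ω]

theorem eq : Tame (fun x y : X => x = y) :=
  ⟨Unit, inferInstance, fun _ => Set.univ, fun _ => id, fun _ => .univ, fun _ => measurable_id,
    fun x y => by simp⟩

theorem graph {h : X → Y} (hh : Measurable h) : Tame (fun x y => h x = y) :=
  ⟨Unit, inferInstance, fun _ => Set.univ, fun _ => h, fun _ => .univ, fun _ => hh,
    fun x y => by simp⟩

theorem comp {R : X → Y → Prop} {S : Y → Z → Prop} (hR : Tame R) (hS : Tame S) :
    Tame (Relation.Comp R S) := by
  obtain ⟨ι, _, D, h, hD, hh, hR⟩ := hR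
  obtain ⟨κ, _, E, k, hE, hk, hS⟩ := hS
  refine ⟨ι × κ, inferInstance, fun i => D i.1 ∩ h i.1 ⁻¹' E i.2, fun i => k i.2 ∘ h i.1,
    fun i => (hD _).inter (hh _ (hE _)), fun i => (hk _).comp (hh _), fun x z => ?_⟩
  constructor
  · rintro ⟨y, hxy, hyz⟩
    obtain ⟨i, hi, rfl⟩ := (hR _ _).1 hxy
    obtain ⟨j, hj, rfl⟩ := (hS _ _).1 hyz
    exact ⟨(i, j), ⟨hi, hj⟩, rfl⟩
  · rintro ⟨⟨i, j⟩, ⟨hi, hj⟩, rfl⟩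
    exact ⟨h i x, (hR _ _).2 ⟨i, hi, rfl⟩, (hS _ _).2 ⟨j, hj, rfl⟩⟩

theorem iUnion {κ : Type} [Countable κ] {R : κ → X → Y → Prop} (hR : ∀ k, Tame (R k)) :
    Tame (fun x y => ∃ k, R k x y) := by
  choose ι hι D h hD hh hR using hR
  refine ⟨Σ k, ι k, inferInstance, fun i => D i.1 i.2, fun i => h i.1 i.2, fun i => hD _ _,
    fun i => hh _ _, fun x y => ?_⟩
  simp [hR]

theorem restrict {R : X → Y → Prop} (hR : Tame R) {Q : Set (X × Y)} (hQ : MeasurableSet Q) :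
    Tame (fun x y => R x y ∧ (x, y) ∈ Q) := by
  obtain ⟨ι, _, D, h, hD, hh, hR⟩ := hR
  refine ⟨ι, inferInstance, fun i => D i ∩ (fun x => (x, h i x)) ⁻¹' Q, h,
    fun i => (hD i).inter ((measurable_id.prodMk (hh i)) hQ), hh, fun x y => ?_⟩
  constructor
  · rintro ⟨hxy, hq⟩
    obtain ⟨i, hi, rfl⟩ := (hR _ _).1 hxy
    exact ⟨i, ⟨hi, hq⟩, rfl⟩
  · rintro ⟨i, ⟨hi, hq⟩, rfl⟩
    exact ⟨(hR _ _).2 ⟨i, hi, rfl⟩, hq⟩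

theorem reflTransGen {R : X → X → Prop} (hR : Tame R) : Tame (Relation.ReflTransGen R) := by
  have key : ∀ n : ℕ, Tame (fun x y => Nat.iterate (fun S => Relation.Comp S R) n Eq x y) := by
    intro n
    induction n with
    | zero => exact eq
    | succ n ih =>
      simp only [Function.iterate_succ_apply']
      exact ih.comp hR
  convert iUnion key using 3 with x y
  constructor
  · intro h
    induction h with
    | refl => exact ⟨0, rfl⟩
    | tail _ h ih =>
      obtain ⟨n, hn⟩ := ih
      refine ⟨n + 1, ?_⟩
      rw [Function.iterate_succ_apply']
      exact ⟨_, hn, h⟩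
  · rintro ⟨n, hn⟩
    induction n generalizing y with
    | zero => cases hn; exact .refl
    | succ n ih =>
      rw [Function.iterate_succ_apply'] at hn
      obtain ⟨z, hz, hzy⟩ := hn
      exact (ih z hz).tail hzy

/-- Quantifying over a section of a tame relation is a countable union of Borel preimages, so
projection causes no loss of Borelness. -/
theorem measurableSet_exists {R : X → Y → Prop} (hR : Tame R) {a : Ω → X} (ha : Measurable a)
    {Q : Set (Ω × Y)} (hQ : MeasurableSet Q) :
    MeasurableSet {ω | ∃ y, R (a ω) y ∧ (ω, y) ∈ Q} := by
  obtain ⟨ι, _, D, h, hD, hh, hR⟩ := hR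
  have : {ω | ∃ y, R (a ω) y ∧ (ω, y) ∈ Q} =
      ⋃ i, a ⁻¹' D i ∩ (fun ω => (ω, h i (a ω))) ⁻¹' Q := by
    ext ω
    simp only [hR, Set.mem_ofPred_eq, Set.mem_iUnion, Set.mem_inter_iff, Set.mem_preimage]
    constructor
    · rintro ⟨y, ⟨i, hi, rfl⟩, hq⟩
      exact ⟨i, hi, hq⟩
    · rintro ⟨i, hi, hq⟩
      exact ⟨_, ⟨i, hi, rfl⟩, hq⟩
  rw [this]
  exact .iUnion fun i => (ha (hD i)).inter ((measurable_id.prodMk ((hh i).comp ha)) hQ)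

theorem measurableSet_forall {R : X → Y → Prop} (hR : Tame R) {a : Ω → X} (ha : Measurable a)
    {Q : Set (Ω × Y)} (hQ : MeasurableSet Q) :
    MeasurableSet {ω | ∀ y, R (a ω) y → (ω, y) ∈ Q} := by
  have := (hR.measurableSet_exists ha hQ.compl).compl
  convert this using 1
  ext ω
  simp

theorem measurableSet [MeasurableEq Y] {R : X → Y → Prop} (hR : Tame R) :
    MeasurableSet {p : X × Y | R p.1 p.2} := by
  have := hR.measurableSet_exists (a := fun p : X × Y => p.1) measurable_fst
    (Q := {p | p.1.2 = p.2})
    (measurableSet_eq_fun (measurable_snd.comp measurable_fst) measurable_snd)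
  convert this using 1
  ext p
  simp

end Tame

/-! ### Isolating points of finite sets and interpolation -/

section Isolate

variable {X : Type*} [MeasurableSpace X]

/-- The preimage of a rational interval under an injection to the reals. -/
def ratInterval (ι : X → ℝ) (ab : ℚ × ℚ) : Set X := ι ⁻¹' Set.Ioo (ab.1 : ℝ) ab.2

theorem measurableSet_ratInterval {ι : X → ℝ} (hι : Measurable ι) (ab : ℚ × ℚ) :
    MeasurableSet (ratInterval ι ab) := hι measurableSet_Ioo

omit [MeasurableSpace X] in
theorem exists_ratInterval {ι : X → ℝ} (hι : Function.Injective ι) {F : Set X} (hF : F.Finite)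
    (x : X) : ∃ ab, x ∈ ratInterval ι ab ∧ ∀ y ∈ F, y ∈ ratInterval ι ab → y = x := by
  have hcl : IsOpen (ι '' (F \ {x}))ᶜ :=
    ((hF.subset Set.sdiff_subset).image ι).isClosed.isOpen_compl
  have hx : ι x ∈ (ι '' (F \ {x}))ᶜ := by
    rintro ⟨y, ⟨-, hy⟩, hyx⟩
    exact hy (hι hyx)
  obtain ⟨u, hu, hxu, hus⟩ :=
    (Real.isTopologicalBasis_Ioo_rat.mem_nhds_iff).1 (hcl.mem_nhds hx)
  simp only [Set.mem_iUnion, Set.mem_singleton_iff] at hu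
  obtain ⟨a, b, -, rfl⟩ := hu
  refine ⟨(a, b), hxu, fun y hy hyu => ?_⟩
  by_contra hne
  exact hus hyu ⟨y, ⟨hy, hne⟩, rfl⟩

/-- A countable family of Borel functions that interpolates every function on every finite set. -/
theorem exists_interpolating [StandardBorelSpace X] (α : Type) [MeasurableSpace α] [Countable α]
    [Nonempty α] : ∃ g : ℕ → X → α, (∀ k, Measurable (g k)) ∧
      ∀ (F : Set X), F.Finite → ∀ f : X → α, ∃ k, ∀ x ∈ F, g k x = f x := by
  classical
  obtain ⟨ι, hι⟩ := MeasureTheory.exists_measurableEmbedding_real X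
  let a0 : α := Classical.arbitrary α
  -- A list is read as a decision list: the first interval containing the point gives the value, and
  -- `a0` is the default.
  let G : List ((ℚ × ℚ) × α) → X → α := fun L =>
    L.rec (fun _ => a0) (fun p _ g => (ratInterval ι p.1).piecewise (fun _ => p.2) g)
  have hG : ∀ L, Measurable (G L) := by
    intro L
    induction L with
    | nil => exact measurable_const
    | cons p L ih =>
      exact Measurable.piecewise (measurableSet_ratInterval hι.measurable _) measurable_const ih
  obtain ⟨e, he⟩ := exists_surjective_nat (List ((ℚ × ℚ) × α))
  refine ⟨fun k => G (e k), fun k => hG _, fun F hF f => ?_⟩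
  suffices ∃ L, ∀ x ∈ F, G L x = f x by
    obtain ⟨L, hL⟩ := this
    obtain ⟨k, rfl⟩ := he L
    exact ⟨k, hL⟩
  induction F, hF using Set.Finite.induction_on with
  | empty => exact ⟨[], by simp⟩
  | @insert x F hx hF ih =>
    obtain ⟨L, hL⟩ := ih
    obtain ⟨ab, hab, hab'⟩ := exists_ratInterval hι.injective hF x
    refine ⟨(ab, f x) :: L, ?_⟩
    rintro y (rfl | hy)
    · exact Set.piecewise_eq_of_mem _ _ _ hab
    · have : y ∉ ratInterval ι ab := fun h => hx (hab' y hy h ▸ hy)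
      exact (Set.piecewise_eq_of_notMem _ _ _ this).trans (hL y hy)

end Isolate

/-! ### Borel maps with bounded fibres -/

section LusinNovikov

theorem measurableSet_strictMono {Z : Type*} [MeasurableSpace Z] {ι : Z → ℝ} (hι : Measurable ι)
    (n : ℕ) : MeasurableSet {w : Fin n → Z | StrictMono (ι ∘ w)} := by
  have : {w : Fin n → Z | StrictMono (ι ∘ w)} =
      ⋂ i, ⋂ j, {w | i < j → ι (w i) < ι (w j)} := by
    ext w
    simp [StrictMono]
  rw [this]
  refine .iInter fun i => .iInter fun j => ?_
  by_cases hij : i < j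
  · simp only [hij, forall_const]
    exact measurableSet_lt (hι.comp (measurable_pi_apply i)) (hι.comp (measurable_pi_apply j))
  · simp [hij]

theorem strictMono_comp_ext {Z : Type*} {ι : Z → ℝ} (hι : Function.Injective ι) {n : ℕ}
    {w w' : Fin n → Z} (hw : StrictMono (ι ∘ w)) (hw' : StrictMono (ι ∘ w'))
    (h : Set.range w = Set.range w') : w = w' := by
  have : ι ∘ w = ι ∘ w' := by
    rw [← StrictMono.range_inj hw hw', Set.range_comp, Set.range_comp, h]
  exact hι.comp_left this

theorem exists_strictMono_enum {Z : Type*} {ι : Z → ℝ} (hι : Function.Injective ι) {F : Set Z}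
    (hF : F.Finite) {n : ℕ} (hn : F.ncard = n) :
    ∃ w : Fin n → Z, StrictMono (ι ∘ w) ∧ Set.range w = F := by
  classical
  subst hn
  have hc : (hF.toFinset.image ι).card = F.ncard := by
    rw [Finset.card_image_of_injective _ hι, Set.ncard_eq_toFinset_card F hF]
  let e := (hF.toFinset.image ι).orderEmbOfFin hc
  have he : ∀ i, ∃ z ∈ F, ι z = e i := by
    intro i
    obtain ⟨z, hz, hze⟩ :=
      Finset.mem_image.1 ((hF.toFinset.image ι).orderEmbOfFin_mem hc i)
    exact ⟨z, hF.mem_toFinset.1 hz, hze⟩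
  choose w hwF hw using he
  have hwe : ι ∘ w = e := funext hw
  refine ⟨w, hwe ▸ e.strictMono, subset_antisymm (by rintro _ ⟨i, rfl⟩; exact hwF i) ?_⟩
  intro z hz
  have : ι z ∈ Set.range e := by
    rw [Finset.range_orderEmbOfFin]
    simpa using ⟨z, hz, rfl⟩
  obtain ⟨i, hi⟩ := this
  exact ⟨i, hι ((hw i).trans hi)⟩

variable {X Z : Type*} [MeasurableSpace X] [StandardBorelSpace X]

/-- The image of a Borel set under a Borel map that is boundedly finite-to-one on it is Borel. -/
theorem measurableSet_image_of_encard_le (N : ℕ) [MeasurableSpace Z] [StandardBorelSpace Z]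
    {π : Z → X} (hπ : Measurable π)
    {T : Set Z} (hT : MeasurableSet T) (h : ∀ x, {z | z ∈ T ∧ π z = x}.encard ≤ N) :
    MeasurableSet (π '' T) := by
  induction N generalizing T with
  | zero =>
    have : T = ∅ := by
      ext z
      have := h (π z)
      simp only [Nat.cast_zero, nonpos_iff_eq_zero, Set.encard_eq_zero] at this
      have h2 : z ∉ ({z' | z' ∈ T ∧ π z' = π z} : Set Z) := by rw [this]; simp
      simpa using h2
    simp [this]
  | succ N ih =>
    obtain ⟨ι, hι⟩ := MeasureTheory.exists_measurableEmbedding_real Z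
    -- Fibres with exactly `N + 1` points have a unique increasing enumeration, so Lusin–Souslin
    -- makes the set `A` of their base points Borel. Off `A` the bound drops to `N`.
    let W : Set (Fin (N + 1) → Z) :=
      {w | StrictMono (ι ∘ w)} ∩ ⋂ j, {w | w j ∈ T ∧ π (w j) = π (w 0)}
    have hW : MeasurableSet W := by
      refine (measurableSet_strictMono hι.measurable _).inter (.iInter fun j => ?_)
      exact (measurable_pi_apply j hT).inter (measurableSet_eq_fun
        (hπ.comp (measurable_pi_apply j)) (hπ.comp (measurable_pi_apply 0)))
    have hrange : ∀ w ∈ W, Set.range w = {z | z ∈ T ∧ π z = π (w 0)} := by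
      intro w hw
      have hsub : Set.range w ⊆ {z | z ∈ T ∧ π z = π (w 0)} := by
        rintro _ ⟨j, rfl⟩
        exact Set.mem_iInter.1 hw.2 j
      refine Set.Finite.eq_of_subset_of_encard_le
        
        ((Set.finite_of_encard_le_coe (h (π (w 0)))).subset hsub) hsub ((h _).trans ?_)
      have : Function.Injective w := hw.1.injective.of_comp
      rw [← Set.image_univ, this.encard_image, Set.encard_univ]
      simp
    have hinj : Set.InjOn (fun w : Fin (N + 1) → Z => π (w 0)) W := by
      intro w hw w' hw' hww'
      refine strictMono_comp_ext hι.injective hw.1 hw'.1 ?_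
      rw [hrange w hw, hrange w' hw']
      simp only at hww'
      rw [hww']
    have hA : MeasurableSet ((fun w : Fin (N + 1) → Z => π (w 0)) '' W) :=
      hW.image_of_measurable_injOn (hπ.comp (measurable_pi_apply 0)) hinj
    set A := (fun w : Fin (N + 1) → Z => π (w 0)) '' W with hAdef
    have hT' := ih (hT.diff (hπ hA)) (by
      intro x
      by_cases hx : x ∈ A
      · have : {z | z ∈ T \ π ⁻¹' A ∧ π z = x} = ∅ := by
          ext z
          simp only [Set.mem_sdiff, Set.mem_preimage, Set.mem_ofPred_eq, Set.mem_empty_iff_false,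
            iff_false]
          rintro ⟨⟨-, h1⟩, rfl⟩
          exact h1 hx
        rw [this]
        simp
      · have hfin : {z | z ∈ T ∧ π z = x}.Finite := Set.finite_of_encard_le_coe (h x)
        refine (Set.encard_le_encard (t := {z | z ∈ T ∧ π z = x}) fun z hz =>
          ⟨hz.1.1, hz.2⟩).trans ?_
        by_contra hlt
        apply hx
        have hcard : {z | z ∈ T ∧ π z = x}.ncard = N + 1 := by
          have h1 := h x
          rw [← hfin.cast_ncard_eq] at h1 hlt
          norm_cast at h1 hlt
          omega
        obtain ⟨w, hw, hwr⟩ := exists_strictMono_enum hι.injective hfin hcard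
        have hwm : ∀ j, w j ∈ T ∧ π (w j) = x := fun j => hwr.subset (Set.mem_range_self j)
        exact ⟨w, ⟨hw, Set.mem_iInter.2 fun j =>
          ⟨(hwm j).1, (hwm j).2.trans (hwm 0).2.symm⟩⟩, (hwm 0).2⟩)
    have : π '' T = A ∪ π '' (T \ π ⁻¹' A) := by
      ext x
      constructor
      · rintro ⟨z, hz, rfl⟩
        by_cases hzA : π z ∈ A
        · exact .inl hzA
        · exact .inr ⟨z, ⟨hz, hzA⟩, rfl⟩
      · rintro (⟨w, hw, rfl⟩ | ⟨z, hz, rfl⟩)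
        · exact ⟨w 0, (Set.mem_iInter.1 hw.2 0).1, rfl⟩
        · exact ⟨z, hz.1, rfl⟩
    rw [this]
    exact hA.union hT'

/-- A bounded form of the Lusin–Novikov uniformization theorem. -/
theorem Tame.of_encard_le (N : ℕ) [MeasurableSpace Z] [StandardBorelSpace Z] [Nonempty Z]
    {π : Z → X} (hπ : Measurable π)
    {T : Set Z} (hT : MeasurableSet T) (h : ∀ x, {z | z ∈ T ∧ π z = x}.encard ≤ N) :
    Tame (fun x z => z ∈ T ∧ π z = x) := by
  obtain ⟨ι, hι⟩ := MeasureTheory.exists_measurableEmbedding_real Z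
  have hfin : ∀ x, {z | z ∈ T ∧ π z = x}.Finite := fun x => Set.finite_of_encard_le_coe (h x)
  -- The base points whose fibre has at least two points in the interval. Removing them leaves in `S
  -- ab` the points alone in the interval within their fibre, where `π` is injective.
  let B : ℚ × ℚ → Set X := fun ab => (fun p : Z × Z => π p.1) ''
    {p | (p.1 ∈ T ∩ ratInterval ι ab ∧ p.2 ∈ T ∩ ratInterval ι ab) ∧ π p.1 = π p.2 ∧
      ι p.1 < ι p.2}
  have hB : ∀ ab, MeasurableSet (B ab) := by
    intro ab
    have hC := hT.inter (measurableSet_ratInterval hι.measurable ab)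
    refine measurableSet_image_of_encard_le (N * N) (hπ.comp measurable_fst) ?_ ?_
    · exact ((measurable_fst hC).inter (measurable_snd hC)).inter
        ((measurableSet_eq_fun (hπ.comp measurable_fst) (hπ.comp measurable_snd)).inter
        (measurableSet_lt (hι.measurable.comp measurable_fst)
          (hι.measurable.comp measurable_snd)))
    · intro x
      refine (Set.encard_le_encard (t := {z | z ∈ T ∧ π z = x} ×ˢ {z | z ∈ T ∧ π z = x}) ?_).trans
        ?_
      · rintro ⟨z, z'⟩ ⟨⟨⟨h1, h2⟩, h3, -⟩, h4⟩
        exact ⟨⟨h1.1, h4⟩, ⟨h2.1, h3.symm.trans h4⟩⟩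
      · rw [Set.encard_prod]
        exact_mod_cast mul_le_mul' (h x) (h x)
  let S : ℚ × ℚ → Set Z := fun ab => (T ∩ ratInterval ι ab) \ π ⁻¹' B ab
  have hS : ∀ ab, MeasurableSet (S ab) := fun ab =>
    (hT.inter (measurableSet_ratInterval hι.measurable ab)).diff (hπ (hB ab))
  have hinj : ∀ ab, Set.InjOn π (S ab) := by
    intro ab z hz z' hz' hzz'
    rcases lt_trichotomy (ι z) (ι z') with hlt | heq | hlt
    · exact absurd ⟨(z, z'), ⟨⟨hz.1, hz'.1⟩, hzz', hlt⟩, rfl⟩ hz.2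
    · exact hι.injective heq
    · exact absurd ⟨(z', z), ⟨⟨hz'.1, hz.1⟩, hzz'.symm, hlt⟩, rfl⟩ hz'.2
  have hext : ∀ ab, ∃ g : X → Z, Measurable g ∧ ∀ z ∈ S ab, g (π z) = z := by
    intro ab
    have := (hS ab).standardBorel
    have hemb : MeasurableEmbedding (fun z : S ab => π z) :=
      (hπ.comp measurable_subtype_coe).measurableEmbedding
        (fun z z' hzz' => Subtype.ext (hinj ab z.2 z'.2 hzz'))
    obtain ⟨g, hg, hgp⟩ := hemb.exists_measurable_extend
      (measurable_subtype_coe (p := (· ∈ S ab))) (fun _ => inferInstance)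
    exact ⟨g, hg, fun z hz => congrFun hgp ⟨z, hz⟩⟩
  choose g hg hgS using hext
  refine ⟨ℚ × ℚ, inferInstance, fun ab => π '' S ab, g,
    fun ab => (hS ab).image_of_measurable_injOn hπ (hinj ab), hg, fun x z => ?_⟩
  constructor
  · rintro ⟨hz, rfl⟩
    obtain ⟨ab, hab, hab'⟩ := exists_ratInterval hι.injective (hfin (π z)) z
    have hzS : z ∈ S ab := by
      refine ⟨⟨hz, hab⟩, ?_⟩
      rintro ⟨p, ⟨⟨h1, h2⟩, h3, h4⟩, h5⟩
      have e1 := hab' p.1 ⟨h1.1, h5⟩ h1.2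
      have e2 := hab' p.2 ⟨h2.1, h3.symm.trans h5⟩ h2.2
      rw [e1, e2] at h4
      exact lt_irrefl _ h4
    exact ⟨ab, ⟨z, hzS, rfl⟩, hgS ab z hzS⟩
  · rintro ⟨ab, ⟨z', hz', rfl⟩, hgz⟩
    rw [hgS ab z' hz'] at hgz
    subst hgz
    exact ⟨hz'.1.1, rfl⟩

end LusinNovikov

/-! ### The finite local lemma by counting -/

section LocalLemma

variable {Ω κ : Type*} [Finite Ω]

/-- The outcomes that avoid all the events `A j`, `j ∈ S`. -/
def avoiding (A : κ → Set Ω) (S : Finset κ) : Set Ω := {ω | ∀ j ∈ S, ω ∉ A j}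

/-- The chain rule: adding the events of `T` one at a time costs a factor of at least `1 - x` each.
-/
theorem ncard_avoiding_union [DecidableEq κ] {A : κ → Set Ω} {x : ℝ} (hx : x ≤ 1)
    {S T : Finset κ} (hST : Disjoint S T)
    (h : ∀ R ⊆ T, ∀ j ∈ T, j ∉ R →
      ((A j ∩ avoiding A (S ∪ R)).ncard : ℝ) ≤ x * (avoiding A (S ∪ R)).ncard) :
    (1 - x) ^ T.card * (avoiding A S).ncard ≤ ((avoiding A (S ∪ T)).ncard : ℝ) := by
  induction T using Finset.induction_on with
  | empty => simp
  | @insert j T hj ih =>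
    have hih := ih (hST.mono_right (Finset.subset_insert _ _)) fun R hR i hi hiR =>
      h R (hR.trans (Finset.subset_insert _ _)) i (Finset.mem_insert_of_mem hi) hiR
    have hstep := h T (Finset.subset_insert _ _) j (Finset.mem_insert_self _ _) hj
    have hsplit : (avoiding A (S ∪ insert j T)).ncard + (A j ∩ avoiding A (S ∪ T)).ncard =
        (avoiding A (S ∪ T)).ncard := by
      rw [← Set.ncard_union_eq]
      · congr 1
        ext ω
        simp only [avoiding, Finset.union_insert, Finset.mem_insert, Set.mem_union,
          Set.mem_ofPred_eq, Set.mem_inter_iff, forall_eq_or_imp]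
        tauto
      · rw [Set.disjoint_left]
        intro ω h1 h2
        exact h1 j (by simp) h2.1
    have hsplit' : ((avoiding A (S ∪ insert j T)).ncard : ℝ) +
        (A j ∩ avoiding A (S ∪ T)).ncard = (avoiding A (S ∪ T)).ncard := by
      exact_mod_cast hsplit
    rw [Finset.card_insert_of_notMem hj, pow_succ]
    nlinarith

/-- The Lovász Local Lemma for counting measures, with a parameter `x`. -/
theorem exists_avoiding_of_le [Nonempty Ω] {A : κ → Set Ω} {I : Finset κ} {Γ : κ → κ → Prop}
    {d : ℕ} {θ x : ℝ} (hx0 : 0 ≤ x) (hx1 : x < 1) (hθx : θ ≤ x * (1 - x) ^ d)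
    (hdeg : ∀ i ∈ I, {j | j ∈ I ∧ j ≠ i ∧ Γ i j}.encard ≤ d)
    (hind : ∀ i ∈ I, ∀ S ⊆ I, (∀ j ∈ S, ¬ Γ i j) →
      ((A i ∩ avoiding A S).ncard : ℝ) ≤ θ * (avoiding A S).ncard) :
    ∃ ω, ∀ i ∈ I, ω ∉ A i := by
  classical
  -- The usual induction: conditionally on avoiding `S`, event `i` has probability at most `x`.
  -- Splitting `S` into neighbours `S₁` and non-neighbours `S₂`, independence bounds the numerator
  -- and the chain rule bounds the denominator.
  have key : ∀ (n : ℕ) (S : Finset κ), S.card = n → S ⊆ I → ∀ i ∈ I, i ∉ S →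
      ((A i ∩ avoiding A S).ncard : ℝ) ≤ x * (avoiding A S).ncard := by
    intro n
    induction n using Nat.strong_induction_on with
    | _ n ih =>
    intro S hSn hSI i hi hiS
    set S₁ := S.filter (Γ i) with hS₁
    set S₂ := S.filter (fun j => ¬ Γ i j) with hS₂
    have hunion : S₂ ∪ S₁ = S := by
      rw [Finset.union_comm]; exact Finset.filter_union_filter_not_eq _ _
    have hdisj : Disjoint S₂ S₁ := (Finset.disjoint_filter_filter_not _ _ _).symm
    have h1 : (1 - x) ^ S₁.card * (avoiding A S₂).ncard ≤ ((avoiding A (S₂ ∪ S₁)).ncard : ℝ) := by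
      refine ncard_avoiding_union hx1.le hdisj fun R hR j hj hjR => ?_
      have hjS : j ∈ S := Finset.filter_subset _ _ hj
      have hjn : j ∉ S₂ ∪ R := by
        rw [Finset.mem_union, not_or]
        exact ⟨Finset.disjoint_right.1 hdisj hj, hjR⟩
      have hsub : S₂ ∪ R ⊆ S := hunion ▸ Finset.union_subset_union_right hR
      refine ih _ ?_ _ rfl (hsub.trans hSI) j (hSI hjS) hjn
      rw [← hSn]
      exact Finset.card_lt_card ((Finset.ssubset_iff_of_subset hsub).2 ⟨j, hjS, hjn⟩)
    have hcard : S₁.card ≤ d := by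
      have h2 : (S₁ : Set κ) ⊆ {j | j ∈ I ∧ j ≠ i ∧ Γ i j} := by
        intro j hj
        have := Finset.mem_filter.1 (Finset.mem_coe.1 hj)
        exact ⟨hSI this.1, fun h => hiS (h ▸ this.1), this.2⟩
      have := (Set.encard_le_encard h2).trans (hdeg i hi)
      rw [Set.encard_coe_eq_coe_finsetCard] at this
      exact_mod_cast this
    have h3 : (1 - x) ^ d * (avoiding A S₂).ncard ≤ ((avoiding A S).ncard : ℝ) := by
      rw [hunion] at h1
      refine le_trans ?_ h1
      gcongr ?_ * _
      exact pow_le_pow_of_le_one (by linarith) (by linarith) hcard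
    have h4 : ((A i ∩ avoiding A S).ncard : ℝ) ≤ (A i ∩ avoiding A S₂).ncard := by
      refine Nat.cast_le.2 (Set.ncard_le_ncard ?_ (Set.toFinite _))
      exact Set.inter_subset_inter_right _ fun ω hω j hj => hω j (Finset.filter_subset _ _ hj)
    have h5 := hind i hi S₂ ((Finset.filter_subset _ _).trans hSI)
      fun j hj => (Finset.mem_filter.1 hj).2
    calc ((A i ∩ avoiding A S).ncard : ℝ) ≤ θ * (avoiding A S₂).ncard := h4.trans h5
      _ ≤ x * (1 - x) ^ d * (avoiding A S₂).ncard := by gcongr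
      _ = x * ((1 - x) ^ d * (avoiding A S₂).ncard) := by ring
      _ ≤ x * (avoiding A S).ncard := by gcongr
  have hfin := ncard_avoiding_union (A := A) (S := ∅) (T := I) hx1.le (Finset.disjoint_empty_left _)
    fun R hR j hj hjR => by
      rw [Finset.empty_union]
      exact key _ R rfl hR j hj hjR
  have huniv : avoiding A (∅ : Finset κ) = Set.univ := by
    ext ω; simp [avoiding]
  rw [huniv, Finset.empty_union, Set.ncard_univ] at hfin
  have hpos : 0 < (1 - x) ^ I.card * (Nat.card Ω : ℝ) := by
    have : 0 < Nat.card Ω := Nat.card_pos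
    have : (0 : ℝ) < 1 - x := by linarith
    positivity
  have hne : (avoiding A I).ncard ≠ 0 := by
    intro h0
    rw [h0, Nat.cast_zero] at hfin
    linarith
  obtain ⟨ω, hω⟩ := Set.nonempty_of_ncard_ne_zero hne
  exact ⟨ω, hω⟩

/-- The symmetric Lovász Local Lemma for counting measures. -/
theorem exists_avoiding [Nonempty Ω] {A : κ → Set Ω} {I : Finset κ} {Γ : κ → κ → Prop}
    {d : ℕ} {θ : ℝ} (hθ : Real.exp 1 * θ * (d + 1) ≤ 1)
    (hdeg : ∀ i ∈ I, {j | j ∈ I ∧ j ≠ i ∧ Γ i j}.encard ≤ d)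
    (hind : ∀ i ∈ I, ∀ S ⊆ I, (∀ j ∈ S, ¬ Γ i j) →
      ((A i ∩ avoiding A S).ncard : ℝ) ≤ θ * (avoiding A S).ncard) :
    ∃ ω, ∀ i ∈ I, ω ∉ A i := by
  rcases Nat.eq_zero_or_pos d with rfl | hd
  -- The general choice `1 / (d + 1)` would equal 1 here, which is not allowed.
  · refine exists_avoiding_of_le (x := Real.exp (-1)) (Real.exp_pos _).le
      (by rw [Real.exp_lt_one_iff]; norm_num) ?_ hdeg hind
    have : Real.exp 1 * Real.exp (-1) = 1 := by rw [← Real.exp_add]; simp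
    have h1 := Real.exp_pos 1
    simp only [Nat.cast_zero, zero_add, mul_one, pow_zero] at hθ ⊢
    nlinarith
  · have hd' : (0 : ℝ) < d := by exact_mod_cast hd
    refine exists_avoiding_of_le (x := 1 / (d + 1)) (by positivity)
      (by rw [div_lt_one (by positivity)]; linarith) ?_ hdeg hind
    have h1 : (1 - 1 / ((d : ℝ) + 1)) = (1 + 1 / (d : ℝ))⁻¹ := by
      field_simp
      ring
    have h2 : (1 + 1 / (d : ℝ)) ^ d ≤ Real.exp 1 := by
      calc (1 + 1 / (d : ℝ)) ^ d ≤ Real.exp (1 / d) ^ d := by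
            gcongr
            rw [add_comm]
            exact Real.add_one_le_exp _
        _ = Real.exp 1 := by
            rw [← Real.exp_nat_mul]
            congr 1
            field_simp
    have h3 : (Real.exp 1)⁻¹ ≤ (1 - 1 / ((d : ℝ) + 1)) ^ d := by
      rw [h1, inv_pow]
      gcongr
    have h4 : θ ≤ 1 / (d + 1) * (Real.exp 1)⁻¹ := by
      rw [← div_eq_mul_inv, div_div, le_div_iff₀ (by positivity)]
      linarith
    exact h4.trans (by gcongr)

/-- Half of the independence of events depending on complementary coordinates. Exchanging the
`D`-coordinates of a pair is injective and carries `(E ∩ G) × univ` into `E × G`. -/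
theorem ncard_inter_mul_card_le {V α : Type*} [Finite V] [Finite α] {E G : Set (V → α)}
    {D : Set V} (hE : ∀ ω ω', (∀ v ∈ D, ω v = ω' v) → ω ∈ E → ω' ∈ E)
    (hG : ∀ ω ω', (∀ v ∉ D, ω v = ω' v) → ω ∈ G → ω' ∈ G) :
    (E ∩ G).ncard * Nat.card (V → α) ≤ E.ncard * G.ncard := by
  classical
  rw [← Set.ncard_univ, ← Set.ncard_prod, ← Set.ncard_prod]
  refine Set.ncard_le_ncard_of_injOn (fun p => (D.piecewise p.1 p.2, D.piecewise p.2 p.1)) ?_ ?_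
    (Set.toFinite _)
  · rintro ⟨m, ω⟩ ⟨⟨hmE, hmG⟩, -⟩
    refine ⟨hE m _ (fun v hv => ?_) hmE, hG m _ (fun v hv => ?_) hmG⟩
    · exact (Set.piecewise_eq_of_mem _ _ _ hv).symm
    · exact (Set.piecewise_eq_of_notMem _ _ _ hv).symm
  · rintro ⟨m, ω⟩ - ⟨m', ω'⟩ - h
    simp only [Prod.mk.injEq] at h
    have h1 := fun v => congrFun h.1 v
    have h2 := fun v => congrFun h.2 v
    refine Prod.ext (funext fun v => ?_) (funext fun v => ?_) <;>
    · have h1 := h1 v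
      have h2 := h2 v
      by_cases hv : v ∈ D <;> simp_all [Set.piecewise]

end LocalLemma

/-! ### Conditional probabilities and one round on a finite set -/

section Codes

/-- A constraint given by an enumeration `t` of its domain and a set `P` of forbidden patterns. -/
structure Code (X : Type*) (q : ℕ) where
  n : ℕ
  P : Finset (Fin n → Fin q)
  t : Fin n → X

variable {X : Type*} {q : ℕ}

open Classical in
/-- The patterns of `c` that agree with `f` on `S`. -/
noncomputable def Code.agreeing (c : Code X q) (S : Set X) (f : X → Fin q) :
    Finset (Fin c.n → Fin q) :=
  c.P.filter fun p => ∀ i, c.t i ∈ S → p i = f (c.t i)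

open Classical in
/-- The probability that `c` is violated by a random coloring that agrees with `f` on `S`. -/
noncomputable def Code.condProb (c : Code X q) (S : Set X) (f : X → Fin q) : ℝ :=
  (c.agreeing S f).card / (q : ℝ) ^ (Finset.univ.filter fun i => c.t i ∉ S).card

theorem Code.condProb_congr {c : Code X q} {S S' : Set X} {f f' : X → Fin q}
    (hS : ∀ i, c.t i ∈ S ↔ c.t i ∈ S') (hf : ∀ i, c.t i ∈ S → f (c.t i) = f' (c.t i)) :
    c.condProb S f = c.condProb S' f' := by
  classical
  have h1 : c.agreeing S f = c.agreeing S' f' := by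
    unfold agreeing
    congr 1
    ext p
    refine forall_congr' fun i => ?_
    rw [← hS i]
    exact forall_congr' fun hi => by rw [hf i hi]
  have h2 : (Finset.univ.filter fun i => c.t i ∉ S) = Finset.univ.filter fun i => c.t i ∉ S' :=
    Finset.filter_congr fun i _ => not_congr (hS i)
  unfold condProb
  rw [h1, h2]

theorem Code.condProb_empty (c : Code X q) (f : X → Fin q) :
    c.condProb ∅ f = c.P.card / (q : ℝ) ^ c.n := by
  simp [condProb, agreeing]

theorem Code.notMem_of_condProb_univ_lt_one {c : Code X q} {f : X → Fin q}
    (h : c.condProb Set.univ f < 1) : f ∘ c.t ∉ c.P := by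
  intro hf
  have : 0 < (c.agreeing Set.univ f).card :=
    Finset.card_pos.2 ⟨f ∘ c.t, by simp [agreeing, hf]⟩
  simp only [condProb, Set.mem_univ, not_true_eq_false, Finset.filter_false, Finset.card_empty,
    pow_zero, div_one] at h
  have : (1 : ℝ) ≤ (c.agreeing Set.univ f).card := by exact_mod_cast this
  linarith

open Classical in
/-- The coloring that is `ω` on `C` and `f` elsewhere. -/
noncomputable def recolor (C : Finset X) (f : X → Fin q) (ω : C → Fin q) : X → Fin q :=
  fun y => if h : y ∈ C then ω ⟨y, h⟩ else f y

theorem recolor_of_mem {C : Finset X} (f : X → Fin q) (ω : C → Fin q) {y : X} (h : y ∈ C) :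
    recolor C f ω y = ω ⟨y, h⟩ := dif_pos h

theorem recolor_of_notMem {C : Finset X} (f : X → Fin q) (ω : C → Fin q) {y : X} (h : y ∉ C) :
    recolor C f ω y = f y := dif_neg h

/-- Overwriting a colouring on the points indexed by `J` loses nothing, since `p` determines the old
values there; hence the pairs inject into all colourings of `C`. -/
theorem Code.card_agreeing_mul_le {c : Code X q} (hc : Function.Injective c.t) {C : Finset X}
    {J : Finset (Fin c.n)} (hJ : ∀ i ∈ J, c.t i ∈ C) (f : X → Fin q) (p : Fin c.n → Fin q) :
    Nat.card {ω : C → Fin q // ∀ i ∈ J, p i = recolor C f ω (c.t i)} * q ^ J.card ≤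
      q ^ C.card := by
  classical
  have h1 : Nat.card (J → Fin q) = q ^ J.card := by simp
  have h2 : Nat.card (C → Fin q) = q ^ C.card := by simp
  rw [← h1, ← h2, ← Nat.card_prod]
  refine Nat.card_le_card_of_injective
    (fun x : {ω : C → Fin q // ∀ i ∈ J, p i = recolor C f ω (c.t i)} × (J → Fin q) =>
      fun v : C => if h : ∃ i : J, c.t i = v then x.2 h.choose else x.1.1 v) ?_
  rintro ⟨⟨ω, hω⟩, η⟩ ⟨⟨ω', hω'⟩, η'⟩ h
  have hv := fun v => congrFun h v
  simp only at hv
  refine Prod.ext (Subtype.ext (funext fun v => ?_)) (funext fun i => ?_)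
  · by_cases hex : ∃ i : J, c.t i = v
    · obtain ⟨i, hi⟩ := hex
      have e1 := hω i i.2
      have e2 := hω' i i.2
      rw [hi, recolor_of_mem _ _ v.2] at e1 e2
      exact e1.symm.trans e2
    · simpa [hex] using hv v
  · have hex : ∃ j : J, c.t j = c.t i := ⟨i, rfl⟩
    have hch : hex.choose = i := Subtype.ext (hc hex.choose_spec)
    have := hv ⟨c.t i, hJ i i.2⟩
    simp only [hex, dif_pos] at this
    simpa [hch] using this

-- The law of total probability, in the direction that Markov's inequality needs.
open Classical in
theorem Code.sum_condProb_le (hq : 0 < q) {c : Code X q} (hc : Function.Injective c.t)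
    {C : Finset X} {S S' : Set X} (hSS' : S ⊆ S') (hCS : ∀ y ∈ C, y ∈ S' ∧ y ∉ S)
    (hcC : ∀ i, c.t i ∈ S' → c.t i ∉ S → c.t i ∈ C) (f : X → Fin q) :
    ∑ ω : C → Fin q, c.condProb S' (recolor C f ω) ≤ (q : ℝ) ^ C.card * c.condProb S f := by
  have hq' : (0 : ℝ) < q := by exact_mod_cast hq
  set J := Finset.univ.filter fun i => c.t i ∈ S' ∧ c.t i ∉ S with hJ
  have hexp : (Finset.univ.filter fun i => c.t i ∉ S).card =
      J.card + (Finset.univ.filter fun i => c.t i ∉ S').card := by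
    rw [← Finset.card_union_of_disjoint]
    · congr 1
      ext i
      simp only [hJ, Finset.mem_filter, Finset.mem_univ, true_and, Finset.mem_union]
      have := @hSS' (c.t i)
      tauto
    · rw [Finset.disjoint_filter]
      tauto
  have hsum : (∑ ω : C → Fin q, (c.agreeing S' (recolor C f ω)).card) * q ^ J.card ≤
      q ^ C.card * (c.agreeing S f).card := by
    have h1 : ∀ ω : C → Fin q, (c.agreeing S' (recolor C f ω)).card ≤
        ∑ p ∈ c.agreeing S f, if ∀ i ∈ J, p i = recolor C f ω (c.t i) then 1 else 0 := by
      intro ω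
      rw [Finset.sum_boole, Nat.cast_id]
      refine Finset.card_le_card fun p hp => ?_
      simp only [agreeing, Finset.mem_filter] at hp ⊢
      refine ⟨⟨hp.1, fun i hi => ?_⟩, fun i hi => ?_⟩
      · rw [hp.2 i (hSS' hi), recolor_of_notMem]
        exact fun h => (hCS _ h).2 hi
      · exact hp.2 i (Finset.mem_filter.1 hi).2.1
    calc _ ≤ (∑ ω : C → Fin q, ∑ p ∈ c.agreeing S f,
            if ∀ i ∈ J, p i = recolor C f ω (c.t i) then 1 else 0) * q ^ J.card := by
          gcongr with ω
          exact h1 ω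
      _ = ∑ p ∈ c.agreeing S f,
            Nat.card {ω : C → Fin q // ∀ i ∈ J, p i = recolor C f ω (c.t i)} * q ^ J.card := by
          rw [Finset.sum_comm, Finset.sum_mul]
          refine Finset.sum_congr rfl fun p _ => ?_
          rw [Finset.sum_boole, Nat.cast_id, Nat.card_eq_fintype_card, Fintype.card_subtype]
      _ ≤ ∑ p ∈ c.agreeing S f, q ^ C.card := by
          refine Finset.sum_le_sum fun p _ => Code.card_agreeing_mul_le hc (fun i hi => ?_) f p
          have := (Finset.mem_filter.1 hi).2
          exact hcC i this.1 this.2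
      _ = _ := by rw [Finset.sum_const, smul_eq_mul, mul_comm]
  have hsum' : (∑ ω : C → Fin q, ((c.agreeing S' (recolor C f ω)).card : ℝ)) * (q : ℝ) ^ J.card ≤
      (q : ℝ) ^ C.card * (c.agreeing S f).card := by exact_mod_cast hsum
  unfold condProb
  rw [hexp, ← Finset.sum_div, pow_add, ← mul_div_assoc, div_le_div_iff₀ (by positivity)
    (by positivity)]
  calc _ = ((∑ ω : C → Fin q, ((c.agreeing S' (recolor C f ω)).card : ℝ)) * (q : ℝ) ^ J.card) *
        (q : ℝ) ^ (Finset.univ.filter fun i => c.t i ∉ S').card := by ring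
    _ ≤ _ := by gcongr

theorem Code.condProb_nonneg (c : Code X q) (S : Set X) (f : X → Fin q) :
    0 ≤ c.condProb S f := by
  unfold condProb
  positivity

/-- Two codes meet if their domains meet. -/
def Code.Meets (c c' : Code X q) : Prop := ∃ i j, c.t i = c'.t j

/-- One round of coloring on a finite set of variables. -/
theorem exists_recoloring (hq : 0 < q) {I : Finset (Code X q)} {d : ℕ} {a b θ : ℝ}
    (hθ : Real.exp 1 * θ * (d + 1) ≤ 1) (hb : 0 < b) (hab : a ≤ θ * b)
    (hinj : ∀ c ∈ I, Function.Injective c.t)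
    (hdeg : ∀ c ∈ I, {c' | c' ∈ I ∧ c' ≠ c ∧ c.Meets c'}.encard ≤ d)
    {C : Finset X} {S S' : Set X} (hSS' : S ⊆ S') (hCS : ∀ y ∈ C, y ∈ S' ∧ y ∉ S)
    (hC : ∀ c ∈ I, ∀ i, c.t i ∈ S' → c.t i ∉ S → c.t i ∈ C) (f : X → Fin q)
    (hf : ∀ c ∈ I, c.condProb S f ≤ a) :
    ∃ f' : X → Fin q, (∀ y ∉ C, f' y = f y) ∧ ∀ c ∈ I, c.condProb S' f' < b := by
  classical
  have : Nonempty (Fin q) := ⟨⟨0, hq⟩⟩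
  have hq' : (0 : ℝ) < q := by exact_mod_cast hq
  let A : Code X q → Set (C → Fin q) := fun c => {ω | b ≤ c.condProb S' (recolor C f ω)}
  have hcard : Nat.card (C → Fin q) = q ^ C.card := by simp
  -- Markov's inequality.
  have hA : ∀ c ∈ I, ((A c).ncard : ℝ) ≤ θ * (q : ℝ) ^ C.card := by
    intro c hc
    have h1 : ((A c).ncard : ℝ) * b ≤ ∑ ω : C → Fin q, c.condProb S' (recolor C f ω) := by
      rw [Set.ncard_eq_toFinset_card', ← nsmul_eq_mul]
      refine le_trans (Finset.card_nsmul_le_sum _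
        (fun ω => c.condProb S' (recolor C f ω)) b fun ω hω => ?_) ?_
      · simpa [A] using hω
      · exact Finset.sum_le_sum_of_subset_of_nonneg (Finset.subset_univ _)
          fun ω _ _ => c.condProb_nonneg _ _
    have h2 := h1.trans (Code.sum_condProb_le hq (hinj c hc) hSS' hCS (hC c hc) f)
    have h3 : (q : ℝ) ^ C.card * c.condProb S f ≤ (q : ℝ) ^ C.card * (θ * b) := by
      gcongr
      exact (hf c hc).trans hab
    have h4 := h2.trans h3
    refine le_of_mul_le_mul_right (h4.trans_eq ?_) hb
    ring
  have hdep : ∀ (c : Code X q) (ω ω' : C → Fin q),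
      (∀ v : C, (∃ i, c.t i = v) → ω v = ω' v) → (ω ∈ A c ↔ ω' ∈ A c) := by
    intro c ω ω' h
    have : c.condProb S' (recolor C f ω) = c.condProb S' (recolor C f ω') := by
      refine Code.condProb_congr (fun _ => Iff.rfl) fun i _ => ?_
      by_cases hi : c.t i ∈ C
      · rw [recolor_of_mem _ _ hi, recolor_of_mem _ _ hi]
        exact h _ ⟨i, rfl⟩
      · rw [recolor_of_notMem _ _ hi, recolor_of_notMem _ _ hi]
    simp only [A, Set.mem_ofPred_eq, this]
  obtain ⟨ω, hω⟩ := exists_avoiding (A := A) (I := I) (Γ := Code.Meets) hθ hdeg (by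
    intro c hc R hR hRc
    have h1 := ncard_inter_mul_card_le (E := A c) (G := avoiding A R)
      (D := {v | ∃ i, c.t i = v}) (fun ω ω' h => (hdep c ω ω' h).1) (by
        intro ω ω' h hω c' hc'
        refine fun hω' => hω c' hc' ((hdep c' ω ω' fun v hv => h v ?_).2 hω')
        rintro ⟨i, hi⟩
        obtain ⟨j, hj⟩ := hv
        exact hRc c' hc' ⟨i, j, hi.trans hj.symm⟩)
    have h2 : ((A c ∩ avoiding A R).ncard : ℝ) * (q : ℝ) ^ C.card ≤
        (A c).ncard * (avoiding A R).ncard := by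
      rw [hcard] at h1
      exact_mod_cast h1
    have h3 : ((A c).ncard : ℝ) * (avoiding A R).ncard ≤
        θ * (q : ℝ) ^ C.card * (avoiding A R).ncard := by
      gcongr
      exact hA c hc
    refine le_of_mul_le_mul_right ((h2.trans h3).trans_eq ?_) (by positivity : 0 < (q : ℝ) ^ C.card)
    ring)
  exact ⟨recolor C f ω, fun y hy => recolor_of_notMem _ _ hy, fun c hc => not_le.1 (hω c hc)⟩

end Codes

/-! ### Finite components and the enclosing step -/

section Components

variable {X : Type*}

/-- `x` and `y` are joined by an `A`-path inside `V` (or are equal). -/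
def Joined (A : X → X → Prop) (V : Set X) : X → X → Prop :=
  Relation.ReflTransGen fun a b => A a b ∧ a ∈ V ∧ b ∈ V

theorem Joined.eq_or_mem {A : X → X → Prop} {V : Set X} {x y : X} (h : Joined A V x y) :
    y = x ∨ x ∈ V ∧ y ∈ V := by
  induction h with
  | refl => exact .inl rfl
  | tail _ hbc ih =>
    rcases ih with rfl | ⟨h, -⟩
    · exact .inr hbc.2
    · exact .inr ⟨h, hbc.2.2⟩

theorem Joined.symm {A : X → X → Prop} (hA : ∀ x y, A x y → A y x) {V : Set X} {x y : X}
    (h : Joined A V x y) : Joined A V y x := by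
  induction h with
  | refl => exact .refl
  | tail _ hbc ih => exact .head ⟨hA _ _ hbc.1, hbc.2.2, hbc.2.1⟩ ih

theorem Joined.mono {A A' : X → X → Prop} (hA : ∀ x y, A x y → A' x y) {V V' : Set X}
    (hV : V ⊆ V') {x y : X} (h : Joined A V x y) : Joined A' V' x y :=
  Relation.ReflTransGen.mono (fun _ _ h => ⟨hA _ _ h.1, hV h.2.1, hV h.2.2⟩) _ _ h

theorem Joined.mem_of_closed {A : X → X → Prop} {V F : Set X}
    (hF : ∀ a ∈ F, ∀ b, A a b → a ∈ V → b ∈ V → b ∈ F) {x y : X} (hx : x ∈ F)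
    (h : Joined A V x y) : y ∈ F := by
  induction h with
  | refl => exact hx
  | tail _ hbc ih => exact hF _ ih _ hbc.1 hbc.2.1 hbc.2.2

theorem Joined.tame [MeasurableSpace X] {A : X → X → Prop} (hA : Tame A) {V : Set X}
    (hV : MeasurableSet V) : Tame (Joined A V) := by
  have : Tame fun a b => A a b ∧ (a, b) ∈ V ×ˢ V := hA.restrict (hV.prod hV)
  exact this.reflTransGen

/-- All `A`-components of `V` are finite. -/
def FinComp (A : X → X → Prop) (V : Set X) : Prop := ∀ x, {y | Joined A V x y}.Finite

/-- The points `A`-related to a point of `U`. -/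
def nbhd (A : X → X → Prop) (U : Set X) : Set X := {y | ∃ x, A y x ∧ x ∈ U}

/-- `x` is separated by `U` from all but finitely many points. -/
def Enclosed (A : X → X → Prop) (U : Set X) (x : X) : Prop :=
  ∃ K : Set X, K.Finite ∧ x ∈ K ∧ ∀ y ∈ K, ∀ z, A y z → z ∈ K ∨ z ∈ U

/-- All sections of `R`, in both directions, are finite. -/
def LocFin {Y : Type*} (R : X → Y → Prop) : Prop :=
  (∀ x, {y | R x y}.Finite) ∧ ∀ y, {x | R x y}.Finite

theorem LocFin.comp {Y Z : Type*} {R : X → Y → Prop} {S : Y → Z → Prop} (hR : LocFin R)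
    (hS : LocFin S) : LocFin (Relation.Comp R S) := by
  constructor
  · intro x
    refine ((hR.1 x).biUnion fun y _ => hS.1 y).subset ?_
    rintro z ⟨y, hxy, hyz⟩
    exact Set.mem_biUnion (show y ∈ {y | R x y} from hxy) hyz
  · intro z
    refine ((hS.2 z).biUnion fun y _ => hR.2 y).subset ?_
    rintro x ⟨y, hxy, hyz⟩
    exact Set.mem_biUnion (show y ∈ {y | S y z} from hyz) hxy

theorem LocFin.flip {Y : Type*} {R : X → Y → Prop} (hR : LocFin R) : LocFin (flip R) :=
  ⟨hR.2, hR.1⟩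

theorem LocFin.of_symm {R : X → X → Prop} (hs : ∀ x y, R x y → R y x)
    (hf : ∀ x, {y | R x y}.Finite) : LocFin R :=
  ⟨hf, fun y => (hf y).subset fun _ h => hs _ _ h⟩

/-- A locally finite tame symmetric relation has a countable Borel coloring. -/
theorem exists_countable_coloring [MeasurableSpace X] [StandardBorelSpace X]
    {H : X → X → Prop} (hH : Tame H) (hf : ∀ x, {y | H x y}.Finite) :
    ∃ E : ℕ → Set X, (∀ k, MeasurableSet (E k)) ∧ (⋃ k, E k) = Set.univ ∧
      ∀ k, ∀ x ∈ E k, ∀ y ∈ E k, H x y → y = x := by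
  classical
  obtain ⟨g, hg, hgi⟩ := exists_interpolating (X := X) Bool
  refine ⟨fun k => g k ⁻¹' {true} ∩
    {x | ∀ y, H x y → (x, y) ∈ {p : X × X | p.2 = p.1 ∨ g k p.2 = false}}, fun k => ?_, ?_, ?_⟩
  · refine (hg k (measurableSet_singleton _)).inter
      (hH.measurableSet_forall measurable_id ?_)
    exact (measurableSet_eq_fun measurable_snd measurable_fst).union
      ((hg k).comp measurable_snd (measurableSet_singleton false))
  · refine Set.eq_univ_of_forall fun x => Set.mem_iUnion.2 ?_
    obtain ⟨k, hk⟩ := hgi (insert x {y | H x y}) ((hf x).insert x) fun y => decide (y = x)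
    refine ⟨k, ?_, fun y hy => ?_⟩
    · simpa using hk x (Set.mem_insert _ _)
    · have := hk y (Set.mem_insert_of_mem _ hy)
      by_cases hyx : y = x
      · exact .inl hyx
      · right
        simpa [hyx] using this
  · rintro k x ⟨-, hx⟩ y ⟨hy, -⟩ hxy
    rcases hx y hxy with h | h
    · exact h
    · exact absurd (hy.symm.trans h) (by simp)

/-- Extending a set whose neighbourhood has finite components by finite boundaries that are
remote from it, so as to enclose non-meagerly many points of a prescribed kind. -/
theorem exists_enclosing_step [MeasurableSpace X] [StandardBorelSpace X] [TopologicalSpace X]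
    {A : X → X → Prop} (hA : Tame A) (hr : ∀ x, A x x) (hs : ∀ x y, A x y → A y x)
    (hf : ∀ x, {y | A x y}.Finite) {U : Set X} (hU : MeasurableSet U)
    (hUf : FinComp A (nbhd A U)) (e : X → X) {O : Set X} (hO : ¬ IsMeagre O) :
    ∃ U' : Set X, (MeasurableSet U' ∧ FinComp A (nbhd A U')) ∧ U ⊆ U' ∧
      (∀ x ∈ U, ∀ y ∈ U', A x y → y ∈ U) ∧
      ∃ B : Set X, MeasurableSet B ∧ ¬ IsMeagre (e ⁻¹' B ∩ O) ∧ ∀ x ∈ B, Enclosed A U' x := by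
  set N := nbhd A U with hN
  have hNm : MeasurableSet N :=
    hA.measurableSet_exists measurable_id (Q := {p | p.2 ∈ U}) (measurable_snd hU)
  set L := Joined A N with hL
  have hLt : Tame L := Joined.tame hA hNm
  have hLs : ∀ x y, L x y → L y x := fun x y h => Joined.symm hs h
  have hLr : ∀ x, L x x := fun x => .refl
  have hAl : LocFin A := .of_symm hs hf
  have hLl : LocFin L := .of_symm hLs hUf
  have hAf : flip A = A := by ext x y; exact ⟨hs _ _, hs _ _⟩
  have hLf : flip L = L := by ext x y; exact ⟨hLs _ _, hLs _ _⟩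
  -- `K x` is `x` together with the `N`-components of its neighbours in `N`. Swallowing whole
  -- components keeps its outer boundary `Bd x` away from `N`, hence away from the neighbours of
  -- `U`.
  let K : X → X → Prop :=
    Relation.Comp (fun x y => A x y ∧ (x, y) ∈ {p : X × X | p.2 ∈ N ∨ p.2 = p.1}) L
  have hKt : Tame K := (hA.restrict ((measurable_snd hNm).union
    (measurableSet_eq_fun measurable_snd measurable_fst))).comp hLt
  have hKAL : ∀ x z, K x z → Relation.Comp A L x z := by
    rintro x z ⟨y, h1, h2⟩
    exact ⟨y, h1.1, h2⟩
  have hKr : ∀ x, K x x := fun x => ⟨x, ⟨hr x, .inr rfl⟩, hLr x⟩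
  let Bd : X → X → Prop := fun x w => Relation.Comp K A x w ∧ ¬ K x w
  have hBdN : ∀ x w, Bd x w → w ∉ N := by
    rintro x w ⟨⟨z, ⟨y, ⟨hxy, hy⟩, hyz⟩, hzw⟩, hnot⟩ hw
    by_cases hz : z ∈ N
    · exact hnot ⟨y, ⟨hxy, hy⟩, hyz.tail ⟨hzw, hz, hw⟩⟩
    · have hzy : z = y := (Joined.eq_or_mem hyz).resolve_right fun h => hz h.2
      subst hzy
      obtain rfl : z = x := hy.resolve_left hz
      exact hnot ⟨w, ⟨hzw, .inl hw⟩, hLr w⟩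
  let ALA : X → X → Prop := Relation.Comp (Relation.Comp A L) A
  let M : X → X → Prop := Relation.Comp ALA A
  let W : X → X → Prop := Relation.Comp (Relation.Comp M A) L
  have hBdALA : ∀ x w, Bd x w → ALA x w := by
    rintro x w ⟨⟨z, hz, hzw⟩, -⟩
    exact ⟨z, hKAL _ _ hz, hzw⟩
  have hALAl : LocFin ALA := (hAl.comp hLl).comp hAl
  have hWl : LocFin W := ((hALAl.comp hAl).comp hAl).comp hLl
  have hALAft : Tame (flip ALA) := by
    simp only [ALA, Relation.flip_comp, hAf, hLf]
    exact hA.comp (hLt.comp hA)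
  have hWt : Tame W := ((((((hA.comp hLt).comp hA)).comp hA).comp hA).comp hLt)
  -- Tameness is not symmetric in its arguments, but the factors are symmetric relations, so the
  -- flip is again a composition of tame ones.
  have hWft : Tame (flip W) := by
    simp only [W, M, Relation.flip_comp, hAf, hLf]
    exact hLt.comp (hA.comp (hA.comp hALAft))
  have hMW : ∀ x v z, M x v → A v z → W x z := fun x v z h1 h2 => ⟨z, ⟨v, h1, h2⟩, hLr z⟩
  -- Within one colour class the finite sets `W x` are pairwise disjoint. Countably many classes
  -- cover the space, so one of them has a preimage non-meager in `O`.
  obtain ⟨E, hEm, hEU, hEi⟩ := exists_countable_coloring (hWt.comp hWft) (hWl.comp hWl.flip).1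
  obtain ⟨k, hk⟩ : ∃ k, ¬ IsMeagre (e ⁻¹' E k ∩ O) := by
    by_contra! h
    refine hO ((isMeagre_iUnion h).mono fun x hx => ?_)
    obtain ⟨k, hk⟩ := Set.mem_iUnion.1 (hEU.symm ▸ Set.mem_univ (e x) : e x ∈ ⋃ k, E k)
    exact Set.mem_iUnion.2 ⟨k, hk, hx⟩
  set B := E k with hB
  have hdisj : ∀ x ∈ B, ∀ y ∈ B, ∀ z, W x z → W y z → y = x :=
    fun x hx y hy z h1 h2 => hEi k x hx y hy ⟨z, h1, h2⟩
  -- The conjunct `flip ALA w x` follows from `Bd x w`; it is there so that the quantifier runs over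
  -- a tame relation.
  let U' : Set X := U ∪ {w | ∃ x, flip ALA w x ∧ x ∈ B ∧ Bd x w}
  have hU'm : MeasurableSet U' := by
    refine hU.union (hALAft.measurableSet_exists measurable_id
      (Q := {p | p.2 ∈ B ∧ Bd p.2 p.1}) ((measurable_snd (hEm k)).inter ?_))
    exact ((hKt.comp hA).measurableSet.preimage measurable_swap).inter
      (hKt.measurableSet.preimage measurable_swap).compl
  have hN' : ∀ v ∈ nbhd A U', v ∈ N ∨ ∃ x ∈ B, M x v := by
    rintro v ⟨w, hvw, hw | ⟨x, -, hx, hxw⟩⟩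
    · exact .inl ⟨w, hvw, hw⟩
    · exact .inr ⟨x, hx, w, hBdALA _ _ hxw, hs _ _ hvw⟩
  -- Inside `nbhd A U'` no path leaves `W x`: a step either stays in an `N`-component, which `W`
  -- absorbs, or touches some `M y`, and disjointness forces `y = x`. Components that avoid every `M
  -- x` are components of the old neighbourhood.
  have hclosed : ∀ x ∈ B, ∀ z, W x z → ∀ v, A z v → z ∈ nbhd A U' → v ∈ nbhd A U' → W x v := by
    intro x hx z hxz v hzv hz hv
    rcases hN' v hv with hv | ⟨y, hy, hyv⟩
    · rcases hN' z hz with hz | ⟨y, hy, hyz⟩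
      · obtain ⟨w', hw', hwz⟩ := hxz
        exact ⟨w', hw', hwz.tail ⟨hzv, hz, hv⟩⟩
      · obtain rfl := hdisj x hx y hy z hxz (hMW _ _ _ hyz (hr z))
        exact hMW _ _ _ hyz hzv
    · obtain rfl := hdisj x hx y hy z hxz (hMW _ _ _ hyv (hs _ _ hzv))
      exact hMW _ _ _ hyv (hr v)
  refine ⟨U', ⟨hU'm, fun x₀ => ?_⟩, Set.subset_union_left, ?_, B, hEm k, hk, fun x hx => ?_⟩
  · by_cases hex : ∃ x ∈ B, ∃ z, M x z ∧ Joined A (nbhd A U') x₀ z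
    · obtain ⟨x, hx, z, hxz, hz⟩ := hex
      refine (hWl.1 x).subset fun y hy => ?_
      exact Joined.mem_of_closed (F := {y | W x y}) (fun a ha b => hclosed x hx a ha b)
        (hMW _ _ _ hxz (hr z)) ((Joined.symm hs hz).trans hy)
    · push Not at hex
      refine (hUf x₀).subset fun y hy => ?_
      have hmem : ∀ b, b ∈ nbhd A U' → Joined A (nbhd A U') x₀ b → b ∈ N := fun b hb hxb =>
        (hN' b hb).resolve_right fun ⟨x, hx, hxb'⟩ => hex x hx b hxb' hxb
      change Joined A (nbhd A U') x₀ y at hy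
      change Joined A N x₀ y
      induction hy with
      | refl => exact .refl
      | tail hb hbc ih => exact ih.tail ⟨hbc.1, hmem _ hbc.2.1 hb, hmem _ hbc.2.2 (hb.tail hbc)⟩
  · rintro x hx y (hy | ⟨z, -, -, hzy⟩) hxy
    · exact hy
    · exact absurd ⟨x, hs _ _ hxy, hx⟩ (hBdN _ _ hzy)
  · refine ⟨{y | K x y}, ((hAl.comp hLl).1 x).subset fun y hy => hKAL _ _ hy, hKr x, ?_⟩
    intro y hy z hyz
    by_cases hz : K x z
    · exact .inl hz
    · have hbd : Bd x z := ⟨⟨y, hy, hyz⟩, hz⟩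
      exact .inr (.inr ⟨x, hBdALA _ _ hbd, hx, hbd⟩)

end Components

/-! ### Partitions into finite components -/

section Category

variable {X : Type*} [TopologicalSpace X]

/-- By the Baire property the complement is open modulo meager; if that open set were nonempty, it
would contain a basic `O` in which `S` is meager. -/
theorem mem_residual_of_not_isMeagre_inter [SecondCountableTopology X] [MeasurableSpace X]
    [BorelSpace X] {S : Set X} (hS : MeasurableSet S)
    (h : ∀ O ∈ TopologicalSpace.countableBasis X, ¬ IsMeagre (S ∩ O)) : S ∈ residual X := by
  obtain ⟨u, hu, hSu⟩ := hS.compl.residualEq_isOpen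
  rw [Filter.eventuallyEq_set] at hSu
  rcases u.eq_empty_or_nonempty with rfl | ⟨x, hx⟩
  · filter_upwards [hSu] with x hx
    simpa using hx
  · obtain ⟨O, hO, -, hOu⟩ :=
      (TopologicalSpace.isBasis_countableBasis X).exists_subset_of_mem_open hx hu
    refine absurd ?_ (h O hO)
    rw [IsMeagre]
    filter_upwards [hSu] with y hy hyS
    exact hy.2 (hOu hyS.2) hyS.1

/-- Off a meager invariant Borel set, a locally finite Borel graph on a Polish space can be
partitioned into two Borel sets with finite components. -/
theorem exists_finComp_partition [Nonempty X] [MeasurableSpace X] [PolishSpace X] [BorelSpace X]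
    {A : X → X → Prop} (hA : Tame A) (hr : ∀ x, A x x) (hs : ∀ x y, A x y → A y x)
    (hf : ∀ x, {y | A x y}.Finite) :
    ∃ U G : Set X, MeasurableSet U ∧ MeasurableSet G ∧ G ∈ residual X ∧
      (∀ x ∈ G, ∀ y, A x y → y ∈ G) ∧
      ∀ x ∈ G, {y | Joined A U x y}.Finite ∧ {y | Joined A Uᶜ x y}.Finite := by
  have hconn : Tame (Joined A Set.univ) := Joined.tame hA .univ
  obtain ⟨ι, hι, D, h, hD, hh, hDh⟩ := id hconn
  -- One requirement for each function covering the connectedness relation and each basic open set: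
  -- meeting them all makes every `h i ⁻¹' C` comeager, hence also the set of points whose whole
  -- component lies in `C`.
  let J := ι × TopologicalSpace.countableBasis X
  have hJne : Nonempty J := by
    obtain ⟨x⟩ := ‹Nonempty X›
    obtain ⟨i, -⟩ := (hDh x x).1 .refl
    obtain ⟨O, hO, -, -⟩ := (TopologicalSpace.isBasis_countableBasis X).exists_subset_of_mem_open
      (Set.mem_univ x) isOpen_univ
    exact ⟨(i, ⟨O, hO⟩)⟩
  obtain ⟨r, hrs⟩ := exists_surjective_nat J
  have hO : ∀ j : J, ¬ IsMeagre (j.2 : Set X) := fun j =>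
    not_isMeagre_of_isOpen ((TopologicalSpace.isBasis_countableBasis X).isOpen j.2.2)
      (TopologicalSpace.nonempty_of_mem_countableBasis j.2.2)
  let State := {U : Set X // MeasurableSet U ∧ FinComp A (nbhd A U)}
  have hstep : ∀ (s : State) (j : J), ∃ s' : State, s.1 ⊆ s'.1 ∧
      (∀ x ∈ s.1, ∀ y ∈ s'.1, A x y → y ∈ s.1) ∧
      ∃ B : Set X, MeasurableSet B ∧ ¬ IsMeagre (h j.1 ⁻¹' B ∩ j.2) ∧
        ∀ x ∈ B, Enclosed A s'.1 x := by
    intro s j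
    obtain ⟨U', hU', hrest⟩ := exists_enclosing_step hA hr hs hf s.2.1 s.2.2 (h j.1) (hO j)
    exact ⟨⟨U', hU'⟩, hrest⟩
  choose next hsub hsep B hBm hBO hBe using hstep
  have hinit : MeasurableSet (∅ : Set X) ∧ FinComp A (nbhd A ∅) := by
    refine ⟨.empty, fun x => (Set.finite_singleton x).subset fun y hy => ?_⟩
    rcases Joined.eq_or_mem hy with h | ⟨⟨z, -, hz⟩, -⟩
    · exact h
    · exact absurd hz (Set.notMem_empty z)
  let s : ℕ → State := fun n => n.rec ⟨∅, hinit⟩ fun n t => next t (r n)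
  have hmono : Monotone fun n => (s n).1 := monotone_nat_of_le_succ fun n => hsub (s n) (r n)
  have hsep' : ∀ n m, n ≤ m → ∀ x ∈ (s n).1, ∀ y ∈ (s m).1, A x y → y ∈ (s n).1 := by
    intro n m hnm x hx
    induction m, hnm using Nat.le_induction with
    | base => exact fun y hy _ => hy
    | succ m hnm ih => exact fun y hy hxy => ih y (hsep _ _ x (hmono hnm hx) y hy hxy) hxy
  set U : Set X := ⋃ n, (s n).1 with hU
  set C : Set X := ⋃ n, B (s n) (r n) with hC
  have hCm : MeasurableSet C := .iUnion fun n => hBm _ _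
  have hCe : ∀ x ∈ C, Enclosed A U x := by
    intro x hx
    obtain ⟨n, hn⟩ := Set.mem_iUnion.1 hx
    obtain ⟨K, hK, hxK, hKU⟩ := hBe _ _ x hn
    refine ⟨K, hK, hxK, fun y hy z hyz => (hKU y hy z hyz).imp_right fun hz => ?_⟩
    exact Set.mem_iUnion.2 ⟨n + 1, hz⟩
  refine ⟨U, {x | ∀ y, Joined A Set.univ x y → y ∈ C}, .iUnion fun n => (s n).2.1,
    hconn.measurableSet_forall measurable_id (Q := {p | p.2 ∈ C}) (measurable_snd hCm), ?_, ?_, ?_⟩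
  · have hres : ∀ i, h i ⁻¹' C ∈ residual X := by
      intro i
      refine mem_residual_of_not_isMeagre_inter (hh i hCm) fun O hO hmeagre => ?_
      obtain ⟨n, hn⟩ := hrs (i, ⟨O, hO⟩)
      refine hBO (s n) (r n) (hmeagre.mono ?_)
      rw [hn]
      refine Set.inter_subset_inter_left _ (Set.preimage_mono ?_)
      rw [← hn]
      exact Set.subset_iUnion (fun n => B (s n) (r n)) n
    filter_upwards [(countable_iInter_mem).2 hres] with x hx y hxy
    obtain ⟨i, -, rfl⟩ := (hDh x y).1 hxy
    exact Set.mem_iInter.1 hx i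
  · intro x hx y hxy z hyz
    exact hx z (.head ⟨hxy, trivial, trivial⟩ hyz)
  · intro x hx
    constructor
    -- A path in `U` starting at stage `n` never leaves that stage, by `hsep'`.
    · by_cases hxU : x ∈ U
      · obtain ⟨n, hn⟩ := Set.mem_iUnion.1 hxU
        refine ((s n).2.2 x).subset fun y hy => ?_
        have hmem : y ∈ (s n).1 ∧ Joined A (nbhd A (s n).1) x y := by
          change Joined A U x y at hy
          induction hy with
          | refl => exact ⟨hn, .refl⟩
          | tail _ hbc ih =>
            obtain ⟨m, hm⟩ := Set.mem_iUnion.1 hbc.2.2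
            have hc := hsep' n (max n m) (le_max_left _ _) _ ih.1 _
              (hmono (le_max_right n m) hm) hbc.1
            exact ⟨hc, ih.2.tail ⟨hbc.1, ⟨_, hr _, ih.1⟩, ⟨_, hr _, hc⟩⟩⟩
        exact hmem.2
      · refine (Set.finite_singleton x).subset fun y hy => ?_
        exact (Joined.eq_or_mem hy).resolve_right fun h => hxU h.1
    · obtain ⟨K, hK, hxK, hKU⟩ := hCe x (hx x .refl)
      refine hK.subset fun y hy => ?_
      exact Joined.mem_of_closed (fun a ha b hab _ hb => (hKU a ha b hab).resolve_right hb) hxK hy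

/-- Every locally finite graph can be partitioned into two sets with finite components. -/
theorem exists_finComp_parity {X : Type*} {A : X → X → Prop}
    (hs : ∀ x y, A x y → A y x) (hf : ∀ x, {y | A x y}.Finite) :
    ∃ U : Set X, FinComp A U ∧ FinComp A Uᶜ := by
  classical
  let S : Setoid X := ⟨Joined A Set.univ, fun _ => .refl, fun h => Joined.symm hs h,
    fun h h' => h.trans h'⟩
  let root : X → X := fun x => (Quotient.mk S x).out
  have hroot : ∀ x, Joined A Set.univ (root x) x := fun x => Quotient.mk_out (s := S) x
  have hrootA : ∀ x y, A x y → root x = root y := fun x y h =>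
    congrArg Quotient.out (Quotient.sound (s := S) (.single ⟨h, trivial, trivial⟩))
  let ball : X → ℕ → Set X := fun x n => (fun F => ⋃ y ∈ F, {z | A y z})^[n] {x}
  have hball : ∀ x n, ball x (n + 1) = ⋃ y ∈ ball x n, {z | A y z} := fun x n =>
    Function.iterate_succ_apply' _ _ _
  have hballf : ∀ x n, (ball x n).Finite := by
    intro x n
    induction n with
    | zero => exact Set.finite_singleton x
    | succ n ih =>
      rw [hball]
      exact ih.biUnion fun y _ => hf y
  have hballA : ∀ x n y z, y ∈ ball x n → A y z → z ∈ ball x (n + 1) := by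
    intro x n y z hy hyz
    rw [hball]
    exact Set.mem_biUnion hy hyz
  have hex : ∀ x, ∃ n, x ∈ ball (root x) n := by
    intro x
    have := hroot x
    generalize root x = y at this
    induction this with
    | refl => exact ⟨0, rfl⟩
    | tail _ hbc ih =>
      obtain ⟨n, hn⟩ := ih
      exact ⟨n + 1, hballA _ _ _ _ hn hbc.1⟩
  let ht : X → ℕ := fun x => Nat.find (hex x)
  have hht : ∀ x, x ∈ ball (root x) (ht x) := fun x => Nat.find_spec (hex x)
  have hle : ∀ x y, A x y → ht y ≤ ht x + 1 := fun x y hxy =>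
    Nat.find_min' (hex y) (hrootA x y hxy ▸ hballA _ _ _ _ (hht x) hxy)
  -- Heights of adjacent points differ by at most one, so equal parity means equal height: a
  -- component lies in one finite sphere about the root.
  have key : ∀ V : Set X, (∀ x y, A x y → x ∈ V → y ∈ V → ht y % 2 = ht x % 2) → FinComp A V := by
    intro V hV x
    refine (hballf (root x) (ht x)).subset fun y hy => ?_
    have : root y = root x ∧ ht y = ht x := by
      refine Joined.mem_of_closed (F := {y | root y = root x ∧ ht y = ht x}) ?_ ⟨rfl, rfl⟩ hy
      rintro a ⟨ha1, ha2⟩ b hab ha hb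
      refine ⟨(hrootA a b hab).symm.trans ha1, ?_⟩
      have h1 := hle a b hab
      have h2 := hle b a (hs _ _ hab)
      have h3 := hV a b hab ha hb
      omega
    rw [← this.1, ← this.2]
    exact hht y
  refine ⟨{x | ht x % 2 = 0}, key _ fun x y _ hx hy => ?_, key _ fun x y _ hx hy => ?_⟩
  · exact Eq.trans hy (Eq.symm hx)
  · have h1 : ht x % 2 ≠ 0 := hx
    have h2 : ht y % 2 ≠ 0 := hy
    omega

end Category

/-! ### Borel families of codes and the two-round colouring -/

variable {X : Type*} {q : ℕ}

/-- A set of codes with Borel sections, injective enumerations and bounded degree. -/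
structure IsBoundedBorel [MeasurableSpace X] (𝓒 : Set (Code X q)) (d : ℕ) : Prop where
  measurableSet : ∀ n P, MeasurableSet {t : Fin n → X | (⟨n, P, t⟩ : Code X q) ∈ 𝓒}
  injective : ∀ c ∈ 𝓒, Function.Injective c.t
  degree_le : ∀ c ∈ 𝓒, {c' | c' ∈ 𝓒 ∧ c' ≠ c ∧ c.Meets c'}.encard ≤ d

/-- Two points are adjacent if they are equal or belong to the domain of one code. -/
def CodeAdj (𝓒 : Set (Code X q)) (x y : X) : Prop :=
  x = y ∨ ∃ c ∈ 𝓒, ∃ i j, c.t i = x ∧ c.t j = y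

theorem CodeAdj.refl (𝓒 : Set (Code X q)) (x : X) : CodeAdj 𝓒 x x := .inl rfl

theorem CodeAdj.symm {𝓒 : Set (Code X q)} (x y : X) (h : CodeAdj 𝓒 x y) : CodeAdj 𝓒 y x := by
  rcases h with rfl | ⟨c, hc, i, j, hi, hj⟩
  · exact .inl rfl
  · exact .inr ⟨c, hc, j, i, hj, hi⟩

theorem CodeAdj.of_mem {𝓒 : Set (Code X q)} {c : Code X q} (hc : c ∈ 𝓒) (i j : Fin c.n) :
    CodeAdj 𝓒 (c.t i) (c.t j) := .inr ⟨c, hc, i, j, rfl, rfl⟩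

namespace IsBoundedBorel

variable [MeasurableSpace X] {𝓒 : Set (Code X q)} {d : ℕ}

/-- Once one code through `x` is fixed, all the others meet it. -/
theorem encard_le (h : IsBoundedBorel 𝓒 d) (x : X) :
    {c | c ∈ 𝓒 ∧ ∃ i, c.t i = x}.encard ≤ (d + 1 : ℕ) := by
  rcases Set.eq_empty_or_nonempty {c | c ∈ 𝓒 ∧ ∃ i, c.t i = x} with he | ⟨c, hc, i, hi⟩
  · simp [he]
  · refine (Set.encard_le_encard (t := insert c {c' | c' ∈ 𝓒 ∧ c' ≠ c ∧ c.Meets c'}) ?_).trans ?_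
    · rintro c' ⟨hc', j, hj⟩
      by_cases hcc : c' = c
      · exact .inl hcc
      · exact .inr ⟨hc', hcc, i, j, hi.trans hj.symm⟩
    · refine (Set.encard_insert_le _ _).trans ?_
      push_cast
      gcongr
      exact h.degree_le c hc

theorem finite_codes (h : IsBoundedBorel 𝓒 d) (x : X) : {c | c ∈ 𝓒 ∧ ∃ i, c.t i = x}.Finite :=
  Set.finite_of_encard_le_coe (h.encard_le x)

theorem finite_adj (h : IsBoundedBorel 𝓒 d) (x : X) : {y | CodeAdj 𝓒 x y}.Finite := by
  refine (((h.finite_codes x).biUnion fun c _ => Set.finite_range c.t).insert x).subset ?_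
  rintro y (rfl | ⟨c, hc, i, j, hi, hj⟩)
  · exact Set.mem_insert _ _
  · exact Set.mem_insert_of_mem _ (Set.mem_biUnion (show c ∈ {c | _} from ⟨hc, i, hi⟩) ⟨j, hj⟩)

theorem tame_incidence [StandardBorelSpace X] [Nonempty X] (h : IsBoundedBorel 𝓒 d) (n : ℕ)
    (P : Finset (Fin n → Fin q)) (i : Fin n) :
    Tame fun (x : X) t => t ∈ {t : Fin n → X | (⟨n, P, t⟩ : Code X q) ∈ 𝓒} ∧ t i = x := by
  refine Tame.of_encard_le (d + 1) (π := fun t : Fin n → X => t i) (measurable_pi_apply i)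
    (h.measurableSet n P) fun x => ?_
  refine le_trans ?_ (h.encard_le x)
  rw [← Function.Injective.encard_image (f := fun t : Fin n → X => (⟨n, P, t⟩ : Code X q))
    (fun t t' htt' => by simpa using htt')]
  refine Set.encard_le_encard ?_
  rintro _ ⟨t, ⟨ht, hi⟩, rfl⟩
  exact ⟨ht, i, hi⟩

theorem tame_adj [StandardBorelSpace X] [Nonempty X] (h : IsBoundedBorel 𝓒 d) :
    Tame (CodeAdj 𝓒) := by
  have h1 : Tame fun x y : X => ∃ k : Σ n, Finset (Fin n → Fin q) × Fin n × Fin n,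
      Relation.Comp (fun (x : X) t =>
          t ∈ {t : Fin k.1 → X | (⟨k.1, k.2.1, t⟩ : Code X q) ∈ 𝓒} ∧ t k.2.2.1 = x)
        (fun t y => t k.2.2.2 = y) x y :=
    Tame.iUnion fun k => (h.tame_incidence _ _ _).comp (Tame.graph (measurable_pi_apply _))
  have h2 : Tame fun x y : X => ∃ b : Bool, cond b (x = y)
      (∃ k : Σ n, Finset (Fin n → Fin q) × Fin n × Fin n,
      Relation.Comp (fun (x : X) t =>
          t ∈ {t : Fin k.1 → X | (⟨k.1, k.2.1, t⟩ : Code X q) ∈ 𝓒} ∧ t k.2.2.1 = x)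
        (fun t y => t k.2.2.2 = y) x y) := by
    refine Tame.iUnion fun b => ?_
    cases b
    · exact h1
    · exact Tame.eq
  convert h2 using 3 with x y
  constructor
  · rintro (rfl | ⟨⟨n, P, t⟩, hc, i, j, hi, hj⟩)
    · exact ⟨true, rfl⟩
    · exact ⟨false, ⟨n, P, i, j⟩, t, ⟨hc, hi⟩, hj⟩
  · rintro ⟨_ | _, hb⟩
    · obtain ⟨⟨n, P, i, j⟩, t, ⟨hc, hi⟩, hj⟩ := hb
      exact .inr ⟨⟨n, P, t⟩, hc, i, j, hi, hj⟩
    · exact .inl hb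

end IsBoundedBorel

/-- For fixed `P` the value depends only on the finite datum of memberships and colours along `t`.
-/
theorem measurable_condProb [MeasurableSpace X] {n : ℕ} (P : Finset (Fin n → Fin q)) {S : Set X}
    (hS : MeasurableSet S) {f : X → Fin q} (hf : Measurable f) :
    Measurable fun t : Fin n → X => (⟨n, P, t⟩ : Code X q).condProb S f := by
  classical
  let F : (Fin n → Prop × Fin q) → ℝ := fun v =>
    (P.filter fun p => ∀ i, (v i).1 → p i = (v i).2).card /
      (q : ℝ) ^ (Finset.univ.filter fun i => ¬ (v i).1).card
  have h1 : Measurable F := measurable_of_countable F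
  have h2 : Measurable fun (t : Fin n → X) (i : Fin n) => (t i ∈ S, f (t i)) :=
    measurable_pi_lambda _ fun i =>
      ((measurable_mem.2 hS).comp (measurable_pi_apply i)).prodMk (hf.comp (measurable_pi_apply i))
  have h3 : (fun t : Fin n → X => (⟨n, P, t⟩ : Code X q).condProb S f) =
      fun t => F fun i => (t i ∈ S, f (t i)) := by
    funext t
    simp only [Code.condProb, Code.agreeing, F]
  rw [h3]
  exact h1.comp h2

/-- One round of the two-round coloring: conditioning on more variables. -/
theorem IsBoundedBorel.exists_round [MeasurableSpace X] [StandardBorelSpace X] [Nonempty X]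
    {𝓒 : Set (Code X q)} {d : ℕ} (h : IsBoundedBorel 𝓒 d) (hq : 0 < q) {a b θ : ℝ}
    (hθ : Real.exp 1 * θ * (d + 1) ≤ 1) (hb : 0 < b) (hab : a ≤ θ * b) (hab' : a < b)
    {S S' : Set X} (hSS' : S ⊆ S') (hfin : FinComp (CodeAdj 𝓒) (S' \ S)) (f : X → Fin q)
    (hf : ∀ c ∈ 𝓒, c.condProb S f ≤ a) :
    ∃ f' : X → Fin q, (∀ c ∈ 𝓒, c.condProb S' f' < b) ∧
      (MeasurableSet S → MeasurableSet S' → Measurable f → Measurable f') := by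
  classical
  have : Nonempty (Fin q) := ⟨⟨0, hq⟩⟩
  set V := S' \ S with hV
  obtain ⟨g, hgm, hg⟩ := exists_interpolating (X := X) (Fin q)
  -- Admissibility of `k` is constant on each `V`-component, hence so is the least admissible `k`;
  -- and all points of a code in `V` lie in one component. So each code that meets `V` sees a single
  -- `g k`.
  let Adm : ℕ → X → Prop := fun k x => x ∈ V → ∀ c ∈ 𝓒, (∃ i, Joined (CodeAdj 𝓒) V x (c.t i)) →
    c.condProb S' (V.piecewise (g k) f) < b
  have hV' : ∀ {x y}, x ∈ V → Joined (CodeAdj 𝓒) V x y → y ∈ V := by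
    intro x y hx hxy
    rcases hxy.eq_or_mem with rfl | h
    · exact hx
    · exact h.2
  have hclass : ∀ x ∈ V, ∀ c ∈ 𝓒, ∀ i, Joined (CodeAdj 𝓒) V x (c.t i) → ∀ j, c.t j ∈ V →
      Joined (CodeAdj 𝓒) V x (c.t j) := fun x hx c hc i hi j hj =>
    hi.tail ⟨CodeAdj.of_mem hc i j, hV' hx hi, hj⟩
  have hex : ∀ x, ∃ k, Adm k x := by
    intro x
    by_cases hx : x ∈ V
    swap
    · exact ⟨0, fun h => absurd h hx⟩
    have hIfin : {c | c ∈ 𝓒 ∧ ∃ i, Joined (CodeAdj 𝓒) V x (c.t i)}.Finite := by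
      refine ((hfin x).biUnion fun y _ => h.finite_codes y).subset ?_
      rintro c ⟨hc, i, hi⟩
      exact Set.mem_biUnion (show c.t i ∈ {y | Joined (CodeAdj 𝓒) V x y} from hi) ⟨hc, i, rfl⟩
    have hI : ∀ c ∈ hIfin.toFinset, c ∈ 𝓒 ∧ ∃ i, Joined (CodeAdj 𝓒) V x (c.t i) := fun c hc =>
      hIfin.mem_toFinset.1 hc
    obtain ⟨f₁, hf₁, hf₁b⟩ := exists_recoloring hq (I := hIfin.toFinset) hθ hb hab
      (fun c hc => h.injective c (hI c hc).1)
      (fun c hc => le_trans (Set.encard_le_encard (fun c' hc' => ⟨(hI c' hc'.1).1, hc'.2⟩ :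
        _ ⊆ {c' | c' ∈ 𝓒 ∧ c' ≠ c ∧ c.Meets c'})) (h.degree_le c (hI c hc).1))
      (C := (hfin x).toFinset) hSS' (fun y hy => hV' hx ((hfin x).mem_toFinset.1 hy))
      (fun c hc i hi hi' => by
        obtain ⟨hc, j, hj⟩ := hI c hc
        exact (hfin x).mem_toFinset.2 (hclass x hx c hc j hj i ⟨hi, hi'⟩))
      f (fun c hc => hf c (hI c hc).1)
    obtain ⟨k, hk⟩ := hg _ (hfin x) f₁
    refine ⟨k, fun _ c hc hci => ?_⟩
    obtain ⟨i, hi⟩ := id hci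
    refine lt_of_eq_of_lt ?_ (hf₁b c (hIfin.mem_toFinset.2 ⟨hc, hci⟩))
    refine Code.condProb_congr (fun _ => Iff.rfl) fun j _ => ?_
    by_cases hj : c.t j ∈ V
    · rw [Set.piecewise_eq_of_mem _ _ _ hj]
      exact hk _ (hclass x hx c hc i hi j hj)
    · rw [Set.piecewise_eq_of_notMem _ _ _ hj]
      exact (hf₁ _ fun hj' => hj (hV' hx ((hfin x).mem_toFinset.1 hj'))).symm
  have hAdm : ∀ {x y}, Joined (CodeAdj 𝓒) V x y → x ∈ V → ∀ k, Adm k x → Adm k y := by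
    intro x y hxy hx k hk _ c hc hci
    obtain ⟨i, hi⟩ := hci
    exact hk hx c hc ⟨i, hxy.trans hi⟩
  have hfind : ∀ {x y}, Joined (CodeAdj 𝓒) V x y → x ∈ V →
      Nat.find (hex x) = Nat.find (hex y) := by
    intro x y hxy hx
    exact le_antisymm
      (Nat.find_min' _ (hAdm (hxy.symm CodeAdj.symm) (hV' hx hxy) _ (Nat.find_spec (hex y))))
      (Nat.find_min' _ (hAdm hxy hx _ (Nat.find_spec (hex x))))
  refine ⟨V.piecewise (fun x => g (Nat.find (hex x)) x) f, fun c hc => ?_, fun hS hS' hfm => ?_⟩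
  · by_cases hcV : ∃ i, c.t i ∈ V
    · obtain ⟨i, hi⟩ := hcV
      refine lt_of_eq_of_lt ?_ (Nat.find_spec (hex (c.t i)) hi c hc ⟨i, .refl⟩)
      refine Code.condProb_congr (fun _ => Iff.rfl) fun j _ => ?_
      by_cases hj : c.t j ∈ V
      · rw [Set.piecewise_eq_of_mem _ _ _ hj, Set.piecewise_eq_of_mem _ _ _ hj,
          hfind (hclass _ hi c hc i .refl j hj) hi]
      · rw [Set.piecewise_eq_of_notMem _ _ _ hj, Set.piecewise_eq_of_notMem _ _ _ hj]
    -- A code that misses `V` gains no conditioning; this is where `a < b` is needed.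
    · push Not at hcV
      refine lt_of_eq_of_lt ?_ ((hf c hc).trans_lt hab')
      refine Code.condProb_congr (fun i => ⟨fun hi => ?_, fun hi => hSS' hi⟩) fun j _ => ?_
      · by_contra hi'
        exact hcV i ⟨hi, hi'⟩
      · rw [Set.piecewise_eq_of_notMem _ _ _ (hcV j)]
  · have hVm : MeasurableSet V := hS'.diff hS
    refine Measurable.piecewise hVm (Measurable.find hgm (fun k => ?_) hex) hfm
    have hset : {x | Adm k x} = Vᶜ ∪ ⋂ m : Σ n, Finset (Fin n → Fin q) × Fin n,
        {x | ∀ t, Relation.Comp (Joined (CodeAdj 𝓒) V) (fun (x : X) t =>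
          t ∈ {t : Fin m.1 → X | (⟨m.1, m.2.1, t⟩ : Code X q) ∈ 𝓒} ∧ t m.2.2 = x) x t →
          (x, t) ∈ {p : X × (Fin m.1 → X) | (⟨m.1, m.2.1, p.2⟩ : Code X q).condProb S'
            (V.piecewise (g k) f) < b}} := by
      ext x
      simp only [Set.mem_union, Set.mem_compl_iff, Set.mem_iInter]
      constructor
      · intro hx
        by_cases hxV : x ∈ V
        · right
          rintro ⟨n, P, i⟩ t ⟨y, hxy, ht, rfl⟩
          exact hx hxV ⟨n, P, t⟩ ht ⟨i, hxy⟩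
        · exact .inl hxV
      · rintro (hx | hx) hxV
        · exact absurd hxV hx
        · rintro ⟨n, P, t⟩ hc ⟨i, hi⟩
          exact hx ⟨n, P, i⟩ t ⟨t i, hi, hc, rfl⟩
    rw [hset]
    refine hVm.compl.union (.iInter fun m => ?_)
    refine ((Joined.tame h.tame_adj hVm).comp (h.tame_incidence _ _ _)).measurableSet_forall
      measurable_id ?_
    exact ((measurable_condProb m.2.1 hS' (Measurable.piecewise hVm (hgm k) hfm)).comp
      measurable_snd) measurableSet_Iio

/-- The two-round coloring along a partition with finite components. -/
theorem IsBoundedBorel.exists_solution_of_finComp [MeasurableSpace X] [StandardBorelSpace X]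
    [Nonempty X] {𝓒 : Set (Code X q)} {d : ℕ} (h : IsBoundedBorel 𝓒 d) (hq : 0 < q) {θ : ℝ}
    (hθ0 : 0 < θ) (hθ : Real.exp 1 * θ * (d + 1) ≤ 1)
    (hp : ∀ c ∈ 𝓒, (c.P.card : ℝ) / (q : ℝ) ^ c.n ≤ θ ^ 2) {U : Set X}
    (hU : FinComp (CodeAdj 𝓒) U) (hU' : FinComp (CodeAdj 𝓒) Uᶜ) :
    ∃ f : X → Fin q, (∀ c ∈ 𝓒, f ∘ c.t ∉ c.P) ∧ (MeasurableSet U → Measurable f) := by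
  have hθ1 : θ < 1 := by
    have h1 : 1 < Real.exp 1 := Real.one_lt_exp_iff.2 one_pos
    have h2 : (0 : ℝ) ≤ d := Nat.cast_nonneg d
    have h3 : θ * Real.exp 1 ≤ Real.exp 1 * θ * (d + 1) := by
      have : 0 < Real.exp 1 * θ := by positivity
      nlinarith
    nlinarith
  -- First round: from θ² to θ, with an irrelevant initial colouring. Second round: from θ to 1.
  obtain ⟨f₁, hf₁, hf₁m⟩ := h.exists_round hq hθ hθ0 (a := θ ^ 2) (by rw [sq]) (by nlinarith)
    (Set.empty_subset U) (by rwa [Set.sdiff_empty]) (fun _ => ⟨0, hq⟩)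
    (fun c hc => (c.condProb_empty _).trans_le (hp c hc))
  obtain ⟨f₂, hf₂, hf₂m⟩ := h.exists_round hq hθ one_pos (a := θ) (by rw [mul_one]) hθ1
    (Set.subset_univ U) (by rwa [← Set.compl_eq_univ_sdiff]) f₁ (fun c hc => (hf₁ c hc).le)
  exact ⟨f₂, fun c hc => Code.notMem_of_condProb_univ_lt_one (hf₂ c hc),
    fun hUm => hf₂m hUm .univ (hf₁m .empty hUm measurable_const)⟩

/-- The Baire measurable local lemma for sets of codes. -/
theorem IsBoundedBorel.exists_baireMeasurable_solution [TopologicalSpace X] [PolishSpace X]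
    [MeasurableSpace X] [BorelSpace X] [Nonempty X] {𝓒 : Set (Code X q)} {d : ℕ}
    (h : IsBoundedBorel 𝓒 d) (hq : 0 < q) {θ : ℝ}
    (hθ0 : 0 < θ) (hθ : Real.exp 1 * θ * (d + 1) ≤ 1)
    (hp : ∀ c ∈ 𝓒, (c.P.card : ℝ) / (q : ℝ) ^ c.n ≤ θ ^ 2) :
    ∃ f : X → Fin q, (∀ c ∈ 𝓒, f ∘ c.t ∉ c.P) ∧ ∀ i, BaireMeasurableSet (f ⁻¹' {i}) := by
  classical
  obtain ⟨U, G, hU, hG, hGres, hGinv, hGfin⟩ :=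
    exists_finComp_partition h.tame_adj (CodeAdj.refl 𝓒) CodeAdj.symm h.finite_adj
  obtain ⟨U₂, hU₂, hU₂'⟩ := exists_finComp_parity CodeAdj.symm h.finite_adj
  obtain ⟨f₂, hf₂, -⟩ := h.exists_solution_of_finComp hq hθ0 hθ hp hU₂ hU₂'
  -- Restricting to codes inside `G` isolates the points outside `G`, so `U ∩ G` splits the whole
  -- space into finite components and the first colouring is Borel everywhere.
  let 𝓒' : Set (Code X q) := {c | c ∈ 𝓒 ∧ ∀ i, c.t i ∈ G}
  have h' : IsBoundedBorel 𝓒' d := by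
    refine ⟨fun n P => ?_, fun c hc => h.injective c hc.1, fun c hc => ?_⟩
    · refine (h.measurableSet n P).inter ?_
      have : {t : Fin n → X | ∀ i, t i ∈ G} = ⋂ i, {t | t i ∈ G} := by ext t; simp
      change MeasurableSet {t : Fin n → X | ∀ i, t i ∈ G}
      rw [this]
      exact .iInter fun i => measurable_pi_apply i hG
    · refine le_trans (Set.encard_le_encard ?_) (h.degree_le c hc.1)
      exact fun c' hc' => ⟨hc'.1.1, hc'.2⟩
  have hadj : ∀ x y, CodeAdj 𝓒' x y → CodeAdj 𝓒 x y ∧ (x = y ∨ x ∈ G ∧ y ∈ G) := by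
    rintro x y (rfl | ⟨c, hc, i, j, rfl, rfl⟩)
    · exact ⟨.inl rfl, .inl rfl⟩
    · exact ⟨CodeAdj.of_mem hc.1 i j, .inr ⟨hc.2 i, hc.2 j⟩⟩
  obtain ⟨f₁, hf₁, hf₁m⟩ := h'.exists_solution_of_finComp hq hθ0 hθ (fun c hc => hp c hc.1)
    (U := U ∩ G) (by
      intro x
      by_cases hx : x ∈ G
      · exact (hGfin x hx).1.subset fun y hy =>
          hy.mono (fun _ _ h => (hadj _ _ h).1) Set.inter_subset_left
      · refine (Set.finite_singleton x).subset fun y hy => ?_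
        exact hy.eq_or_mem.resolve_right fun h => hx h.1.2) (by
      intro x
      have key : ∀ y, Joined (CodeAdj 𝓒') (U ∩ G)ᶜ x y →
          y = x ∨ x ∈ G ∧ y ∈ G ∧ Joined (CodeAdj 𝓒) Uᶜ x y := by
        intro y hy
        induction hy with
        | refl => exact .inl rfl
        | @tail b c _ hbc ih =>
          obtain ⟨h1, rfl | ⟨hb, hc⟩⟩ := hadj _ _ hbc.1
          · exact ih
          · have hbU : b ∈ Uᶜ := fun h => hbc.2.1 ⟨h, hb⟩
            have hcU : c ∈ Uᶜ := fun h => hbc.2.2 ⟨h, hc⟩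
            rcases ih with rfl | ⟨hx, -, hj⟩
            · exact .inr ⟨hb, hc, .single ⟨h1, hbU, hcU⟩⟩
            · exact .inr ⟨hx, hc, hj.tail ⟨h1, hbU, hcU⟩⟩
      by_cases hx : x ∈ G
      · refine ((hGfin x hx).2.insert x).subset fun y hy => ?_
        exact (key y hy).imp id fun h => h.2.2
      · refine (Set.finite_singleton x).subset fun y hy => ?_
        exact (key y hy).resolve_right fun h => hx h.1)
  refine ⟨G.piecewise f₁ f₂, fun c hc => ?_, fun i => ?_⟩
  · by_cases hcG : ∃ i, c.t i ∈ G
    · obtain ⟨i, hi⟩ := hcG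
      have hall : ∀ j, c.t j ∈ G := fun j => hGinv _ hi _ (CodeAdj.of_mem hc i j)
      have : G.piecewise f₁ f₂ ∘ c.t = f₁ ∘ c.t :=
        funext fun j => Set.piecewise_eq_of_mem _ _ _ (hall j)
      rw [this]
      exact hf₁ c ⟨hc, hall⟩
    · push Not at hcG
      have : G.piecewise f₁ f₂ ∘ c.t = f₂ ∘ c.t :=
        funext fun j => Set.piecewise_eq_of_notMem _ _ _ (hcG j)
      rw [this]
      exact hf₂ c hc
  · refine BaireMeasurableSet.congr
      (hf₁m (hU.inter hG) (measurableSet_singleton i)).baireMeasurableSet ?_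
    rw [Filter.eventuallyEq_set]
    filter_upwards [hGres] with x hx
    simp [Set.piecewise_eq_of_mem _ _ _ hx]

/-! ### From constraints to codes -/

section Translation

variable {X : Type*} {q n : ℕ}

/-- The partial function `t i ↦ p i`. -/
def patternFun (t : Fin n → X) (ht : Function.Injective t) (p : Fin n → Fin q) : FinFun X q where
  graph := Finset.univ.map ⟨fun i => (t i, p i), fun _ _ h => ht (Prod.ext_iff.1 h).1⟩
  functional := by
    intro a ha b hb hab
    obtain ⟨i, -, rfl⟩ := Finset.mem_map.1 ha
    obtain ⟨j, -, rfl⟩ := Finset.mem_map.1 hb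
    obtain rfl : i = j := ht hab
    rfl

theorem mem_graph_patternFun {t : Fin n → X} {ht : Function.Injective t} {p : Fin n → Fin q}
    {a : X × Fin q} : a ∈ (patternFun t ht p).graph ↔ ∃ i, (t i, p i) = a := by
  refine Finset.mem_map.trans ⟨?_, ?_⟩
  · rintro ⟨i, -, hi⟩
    exact ⟨i, hi⟩
  · rintro ⟨i, hi⟩
    exact ⟨i, Finset.mem_univ _, hi⟩

theorem FinFun.mem_dom {φ : FinFun X q} {x : X} : x ∈ φ.dom ↔ ∃ y, (x, y) ∈ φ.graph := by
  simp [FinFun.dom]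

theorem mem_dom_patternFun {t : Fin n → X} {ht : Function.Injective t} {p : Fin n → Fin q}
    {x : X} : x ∈ (patternFun t ht p).dom ↔ ∃ i, t i = x := by
  simp [FinFun.mem_dom, mem_graph_patternFun]

theorem patternFun_injective {t : Fin n → X} (ht : Function.Injective t) :
    Function.Injective (patternFun (q := q) t ht) := by
  intro p p' h
  funext i
  have h1 : (t i, p i) ∈ (patternFun t ht p').graph := h ▸ mem_graph_patternFun.2 ⟨i, rfl⟩
  obtain ⟨j, hj⟩ := mem_graph_patternFun.1 h1
  obtain rfl : j = i := ht (Prod.ext_iff.1 hj).1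
  exact (Prod.ext_iff.1 hj).2.symm

theorem restrict_eq_patternFun {t : Fin n → X} (ht : Function.Injective t) {D : Finset X}
    (hD : ∀ x, x ∈ D ↔ ∃ i, t i = x) (f : X → Fin q) :
    restrict f D = patternFun t ht (f ∘ t) := by
  ext ⟨x, y⟩
  rw [mem_graph_patternFun]
  simp only [restrict, Finset.mem_map, hD, Function.Embedding.coeFn_mk, Prod.mk.injEq,
    Function.comp_apply]
  constructor
  · rintro ⟨_, ⟨i, rfl⟩, rfl, rfl⟩
    exact ⟨i, rfl, rfl⟩
  · rintro ⟨i, rfl, rfl⟩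
    exact ⟨t i, ⟨i, rfl⟩, rfl, rfl⟩

theorem FinFun.exists_eq_patternFun {t : Fin n → X} (ht : Function.Injective t) {φ : FinFun X q}
    (hD : ∀ x, x ∈ φ.dom ↔ ∃ i, t i = x) : ∃ p, patternFun t ht p = φ := by
  have h : ∀ i, ∃ y, (t i, y) ∈ φ.graph := fun i => FinFun.mem_dom.1 ((hD _).2 ⟨i, rfl⟩)
  choose p hp using h
  refine ⟨p, ?_⟩
  ext a
  rw [mem_graph_patternFun]
  constructor
  · rintro ⟨i, rfl⟩
    exact hp i
  · intro ha
    obtain ⟨i, hi⟩ := (hD a.1).1 (FinFun.mem_dom.2 ⟨a.2, ha⟩)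
    exact ⟨i, φ.functional _ (hp i) _ ha hi⟩

/-- The constraint with domain enumerated by `t` and with forbidden patterns `P`. -/
noncomputable def constraintOf (P : Finset (Fin n → Fin q)) (t : Fin n → X)
    (ht : Function.Injective t) : Constraint X q where
  -- Indexing by `Fin P.card` presents the patterns as an injective tuple of fixed length, the form
  -- in which the Borel structure on finite sets is defined.
  patterns := Finset.univ.map ⟨fun j : Fin P.card => patternFun t ht (P.equivFin.symm j),
    fun _ _ h => P.equivFin.symm.injective (Subtype.ext (patternFun_injective ht h))⟩
  dom_eq := by
    intro φ hφ ψ hψ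
    obtain ⟨i, -, rfl⟩ := Finset.mem_map.1 hφ
    obtain ⟨j, -, rfl⟩ := Finset.mem_map.1 hψ
    ext x
    exact (mem_dom_patternFun (ht := ht)).trans (mem_dom_patternFun (ht := ht)).symm

theorem mem_patterns_constraintOf {P : Finset (Fin n → Fin q)} {t : Fin n → X}
    {ht : Function.Injective t} {φ : FinFun X q} :
    φ ∈ (constraintOf P t ht).patterns ↔ ∃ p ∈ P, patternFun t ht p = φ := by
  refine Finset.mem_map.trans ⟨?_, ?_⟩
  · rintro ⟨j, -, rfl⟩
    exact ⟨_, (P.equivFin.symm j).2, rfl⟩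
  · rintro ⟨p, hp, rfl⟩
    refine ⟨P.equivFin ⟨p, hp⟩, Finset.mem_univ _, ?_⟩
    change patternFun t ht (P.equivFin.symm (P.equivFin ⟨p, hp⟩)).1 = _
    rw [Equiv.symm_apply_apply]

theorem patternFun_mem_patterns {P : Finset (Fin n → Fin q)} {t : Fin n → X}
    {ht : Function.Injective t} {p : Fin n → Fin q} :
    patternFun t ht p ∈ (constraintOf P t ht).patterns ↔ p ∈ P := by
  rw [mem_patterns_constraintOf]
  exact ⟨fun ⟨p', hp', h⟩ => patternFun_injective ht h ▸ hp', fun h => ⟨p, h, rfl⟩⟩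

theorem card_patterns_constraintOf (P : Finset (Fin n → Fin q)) (t : Fin n → X)
    (ht : Function.Injective t) : (constraintOf P t ht).patterns.card = P.card := by
  rw [constraintOf, Finset.card_map, Finset.card_univ, Fintype.card_fin]

theorem mem_dom_constraintOf {P : Finset (Fin n → Fin q)} (hP : P.Nonempty) {t : Fin n → X}
    {ht : Function.Injective t} {x : X} :
    x ∈ (constraintOf P t ht).dom ↔ ∃ i, t i = x := by
  classical
  simp only [Constraint.dom, Finset.mem_biUnion, mem_patterns_constraintOf]
  constructor
  · rintro ⟨_, ⟨p, -, rfl⟩, hx⟩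
    exact mem_dom_patternFun.1 hx
  · intro hx
    obtain ⟨p, hp⟩ := hP
    exact ⟨_, ⟨p, hp, rfl⟩, mem_dom_patternFun.2 hx⟩

theorem card_dom_constraintOf {P : Finset (Fin n → Fin q)} (hP : P.Nonempty) (t : Fin n → X)
    (ht : Function.Injective t) : (constraintOf P t ht).dom.card = n := by
  have : (constraintOf P t ht).dom = Finset.univ.map ⟨t, ht⟩ := by
    ext x
    simp [mem_dom_constraintOf hP]
  rw [this, Finset.card_map, Finset.card_univ, Fintype.card_fin]

theorem Constraint.dom_of_mem {B : Constraint X q} {φ : FinFun X q} (hφ : φ ∈ B.patterns) :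
    B.dom = φ.dom := by
  classical
  ext x
  simp only [Constraint.dom, Finset.mem_biUnion]
  exact ⟨fun ⟨ψ, hψ, hx⟩ => B.dom_eq ψ hψ φ hφ ▸ hx, fun hx => ⟨φ, hφ, hx⟩⟩

theorem Constraint.exists_eq_constraintOf {B : Constraint X q} (hB : B.patterns.Nonempty)
    {t : Fin n → X} (ht : Function.Injective t) (hD : ∀ x, x ∈ B.dom ↔ ∃ i, t i = x) :
    ∃ P : Finset (Fin n → Fin q), P.Nonempty ∧ constraintOf P t ht = B := by
  classical
  refine ⟨Finset.univ.filter fun p => patternFun t ht p ∈ B.patterns, ?_, ?_⟩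
  · obtain ⟨φ, hφ⟩ := hB
    obtain ⟨p, rfl⟩ := φ.exists_eq_patternFun ht (Constraint.dom_of_mem hφ ▸ hD)
    exact ⟨p, by simpa using hφ⟩
  · ext φ
    rw [mem_patterns_constraintOf]
    constructor
    · rintro ⟨p, hp, rfl⟩
      simpa using hp
    · intro hφ
      obtain ⟨p, rfl⟩ := φ.exists_eq_patternFun ht (Constraint.dom_of_mem hφ ▸ hD)
      exact ⟨p, by simpa using hφ, rfl⟩

theorem measurable_finsetMap {Y : Type*} [MeasurableSpace Y] (k : ℕ) :
    @Measurable {y : Fin k → Y // Function.Injective y} (Finset Y) _ (finsetBorel Y)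
      (fun y => (Finset.univ : Finset (Fin k)).map ⟨y.1, y.2⟩) :=
  measurable_iff_le_map.2 (iInf_le _ k)

theorem measurable_patternFun [MeasurableSpace X] (p : Fin n → Fin q) :
    Measurable fun s : {t : Fin n → X // Function.Injective t} => patternFun s.1 s.2 p := by
  let := finsetBorel (X × Fin q)
  refine measurable_comap_iff.2 ?_
  have h : Measurable fun s : {t : Fin n → X // Function.Injective t} =>
      (⟨fun i => (s.1 i, p i), fun _ _ h => s.2 (Prod.ext_iff.1 h).1⟩ :
        {y : Fin n → X × Fin q // Function.Injective y}) := by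
    refine Measurable.subtype_mk (measurable_pi_lambda _ fun i => ?_)
    exact ((measurable_pi_apply i).comp measurable_subtype_coe).prodMk measurable_const
  exact (measurable_finsetMap n).comp h

theorem measurable_constraintOf [MeasurableSpace X] (P : Finset (Fin n → Fin q)) :
    Measurable fun s : {t : Fin n → X // Function.Injective t} => constraintOf P s.1 s.2 := by
  let := finsetBorel (FinFun X q)
  refine measurable_comap_iff.2 ?_
  have h : Measurable fun s : {t : Fin n → X // Function.Injective t} =>
      (⟨fun j => patternFun s.1 s.2 (P.equivFin.symm j),
        fun _ _ h => P.equivFin.symm.injective (Subtype.ext (patternFun_injective s.2 h))⟩ :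
        {y : Fin P.card → FinFun X q // Function.Injective y}) :=
    Measurable.subtype_mk (measurable_pi_lambda _ fun j => measurable_patternFun _)
  exact (measurable_finsetMap P.card).comp h

/-- The codes with increasing enumerations of the constraints in `𝓑`. -/
def CSP.codes (𝓑 : CSP X q) (ι : X → ℝ) : Set (Code X q) :=
  {c | (c.P.Nonempty ∧ StrictMono (ι ∘ c.t)) ∧
    ∃ ht : Function.Injective c.t, constraintOf c.P c.t ht ∈ 𝓑}

theorem CSP.IsBorel.measurableSet_codes [MeasurableSpace X] [StandardBorelSpace X] {𝓑 : CSP X q}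
    (h𝓑 : 𝓑.IsBorel) {ι : X → ℝ} (hι : Measurable ι) (P : Finset (Fin n → Fin q)) :
    MeasurableSet {t : Fin n → X | (⟨n, P, t⟩ : Code X q) ∈ 𝓑.codes ι} := by
  have hinj : MeasurableSet {t : Fin n → X | Function.Injective t} := by
    have : {t : Fin n → X | Function.Injective t} = ⋂ i, ⋂ j, {t | t i = t j → i = j} := by
      ext t
      simp [Function.Injective]
    rw [this]
    refine .iInter fun i => .iInter fun j => ?_
    by_cases hij : i = j
    · simp [hij]
    · simp only [hij, imp_false]
      exact (measurableSet_eq_fun (measurable_pi_apply i) (measurable_pi_apply j)).compl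
  have h1 : MeasurableSet {t : Fin n → X | P.Nonempty ∧ StrictMono (ι ∘ t)} :=
    (MeasurableSet.const _).inter (measurableSet_strictMono hι n)
  have h2 : MeasurableSet ((↑) '' ((fun s : {t : Fin n → X // Function.Injective t} =>
      constraintOf P s.1 s.2) ⁻¹' 𝓑) : Set (Fin n → X)) :=
    MeasurableSet.subtype_image hinj (measurable_constraintOf P h𝓑)
  convert h1.inter h2 using 1
  ext t
  simp [CSP.codes]

/-- The domain gives `n` and its increasing enumeration `t`, and the patterns then give `P`.
Nonemptiness of `P` matters: the empty constraint forgets its domain. -/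
theorem CSP.constraintOf_injOn {𝓑 : CSP X q} {ι : X → ℝ} (hι : Function.Injective ι)
    {c c' : Code X q} (hc : c ∈ 𝓑.codes ι) (hc' : c' ∈ 𝓑.codes ι)
    (h : constraintOf c.P c.t hc.2.1 = constraintOf c'.P c'.t hc'.2.1) : c = c' := by
  obtain ⟨n, P, t⟩ := c
  obtain ⟨n', P', t'⟩ := c'
  obtain ⟨⟨hP, hm⟩, ht, hB⟩ := hc
  obtain ⟨⟨hP', hm'⟩, ht', hB'⟩ := hc'
  change constraintOf P t ht = constraintOf P' t' ht' at h
  obtain rfl : n = n' := by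
    exact (card_dom_constraintOf hP t ht).symm.trans
      ((congrArg (fun B => B.dom.card) h).trans (card_dom_constraintOf hP' t' ht'))
  obtain rfl : t = t' := by
    refine strictMono_comp_ext hι hm hm' ?_
    ext x
    rw [Set.mem_range, Set.mem_range, ← mem_dom_constraintOf hP (ht := ht), h,
      mem_dom_constraintOf hP']
  obtain rfl : P = P' := by
    ext p
    rw [← patternFun_mem_patterns (ht := ht), h, patternFun_mem_patterns]
  rfl

theorem CSP.exists_code {𝓑 : CSP X q} {ι : X → ℝ} (hι : Function.Injective ι)
    {B : Constraint X q} (hB : B ∈ 𝓑) (hne : B.patterns.Nonempty) :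
    ∃ c, ∃ hc : c ∈ 𝓑.codes ι, constraintOf c.P c.t hc.2.1 = B := by
  obtain ⟨t, htm, htr⟩ := exists_strictMono_enum hι B.dom.finite_toSet rfl
  have ht : Function.Injective t := htm.injective.of_comp
  obtain ⟨P, hP, hPB⟩ := Constraint.exists_eq_constraintOf hne ht fun x =>
    (Set.ext_iff.1 htr x).symm
  exact ⟨⟨_, P, t⟩, ⟨⟨hP, htm⟩, ht, (congrArg (· ∈ 𝓑) hPB).mpr hB⟩, hPB⟩

theorem CSP.IsBorel.isBoundedBorel_codes [MeasurableSpace X] [StandardBorelSpace X] {𝓑 : CSP X q}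
    (h𝓑 : 𝓑.IsBorel) {ι : X → ℝ} (hι : Measurable ι) (hinj : Function.Injective ι) {d : ℕ}
    (hd : 𝓑.d ≤ d) : IsBoundedBorel (𝓑.codes ι) d := by
  classical
  refine ⟨fun n P => h𝓑.measurableSet_codes hι P, fun c hc => hc.2.1, fun c hc => ?_⟩
  refine le_trans ?_ ((le_iSup₂ (f := fun B (_ : B ∈ 𝓑) =>
    {B' | B' ∈ 𝓑 ∧ B ≠ B' ∧ ∃ x, x ∈ B'.dom ∧ x ∈ B.dom}.encard) _ hc.2.2).trans hd)
  -- The empty constraint is a dummy value; codes of `𝓑` have injective enumerations.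
  let F : Code X q → Constraint X q := fun c =>
    if ht : Function.Injective c.t then constraintOf c.P c.t ht else ⟨∅, by simp⟩
  have hF : ∀ c' (hc' : c' ∈ 𝓑.codes ι), F c' = constraintOf c'.P c'.t hc'.2.1 :=
    fun c' hc' => dif_pos hc'.2.1
  rw [← Set.InjOn.encard_image (f := F)]
  · refine Set.encard_le_encard ?_
    rintro _ ⟨c', ⟨hc', hne, i, j, hij⟩, rfl⟩
    rw [hF c' hc']
    refine ⟨hc'.2.2, fun heq => hne (CSP.constraintOf_injOn hinj hc' hc heq.symm), c.t i, ?_, ?_⟩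
    · exact (mem_dom_constraintOf hc'.1.1).2 ⟨j, hij.symm⟩
    · exact (mem_dom_constraintOf hc.1.1).2 ⟨i, rfl⟩
  · rintro c₁ ⟨hc₁, -⟩ c₂ ⟨hc₂, -⟩ h
    rw [hF c₁ hc₁, hF c₂ hc₂] at h
    exact CSP.constraintOf_injOn hinj hc₁ hc₂ h

/-- Codes omit the empty constraint, which is never violated. -/
theorem CSP.not_violates_of_codes {𝓑 : CSP X q} {ι : X → ℝ} (hι : Function.Injective ι)
    {f : X → Fin q} (hf : ∀ c ∈ 𝓑.codes ι, f ∘ c.t ∉ c.P) : 𝓑.IsSolution f := by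
  intro B hB hv
  obtain ⟨c, hc, rfl⟩ := CSP.exists_code hι hB ⟨_, hv⟩
  refine hf c hc ?_
  rw [Constraint.Violates,
    restrict_eq_patternFun hc.2.1 fun x => mem_dom_constraintOf hc.1.1] at hv
  exact patternFun_mem_patterns.1 hv

theorem prob_constraintOf_toReal {P : Finset (Fin n → Fin q)} (hP : P.Nonempty) (t : Fin n → X)
    (ht : Function.Injective t) :
    (constraintOf P t ht).prob.toReal = (P.card : ℝ) / (q : ℝ) ^ n := by
  simp [Constraint.prob, card_patterns_constraintOf, card_dom_constraintOf hP]

theorem CSP.isSolution_of_p_eq_zero {𝓑 : CSP X q} (h : 𝓑.p = 0) (f : X → Fin q) :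
    𝓑.IsSolution f := by
  intro B hB hv
  have h1 : B.prob ≤ 𝓑.p := le_iSup₂ (f := fun B (_ : B ∈ 𝓑) => B.prob) B hB
  rw [h, nonpos_iff_eq_zero, Constraint.prob, ENNReal.div_eq_zero_iff] at h1
  rcases h1 with h1 | h1
  · rw [Nat.cast_eq_zero, Finset.card_eq_zero] at h1
    rw [Constraint.Violates, h1] at hv
    exact Finset.notMem_empty _ hv
  · exact ENNReal.pow_ne_top (ENNReal.natCast_ne_top q) h1

theorem CSP.card_div_le_of_codes {𝓑 : CSP X q} {ι : X → ℝ} {d : ℕ} (hd : 𝓑.d = d)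
    (h : 𝓑.p * ((𝓑.d : ℝ≥0∞) + 1) ^ 2 ≤ ENNReal.ofReal (Real.exp (-2))) {c : Code X q}
    (hc : c ∈ 𝓑.codes ι) :
    (c.P.card : ℝ) / (q : ℝ) ^ c.n ≤ (1 / (Real.exp 1 * (d + 1))) ^ 2 := by
  have h1 : (constraintOf c.P c.t hc.2.1).prob ≤ 𝓑.p :=
    le_iSup₂ (f := fun B (_ : B ∈ 𝓑) => B.prob) _ hc.2.2
  have h2 : (constraintOf c.P c.t hc.2.1).prob * ((d : ℝ≥0∞) + 1) ^ 2 ≤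
      ENNReal.ofReal (Real.exp (-2)) := by
    refine le_trans ?_ h
    rw [hd]
    gcongr
    simp
  have h3 := ENNReal.toReal_mono ENNReal.ofReal_ne_top h2
  have h4 : ((d : ℝ≥0∞) + 1).toReal = (d : ℝ) + 1 := by
    rw [ENNReal.toReal_add (ENNReal.natCast_ne_top d) ENNReal.one_ne_top]
    simp
  rw [ENNReal.toReal_mul, ENNReal.toReal_pow, h4, prob_constraintOf_toReal hc.1.1,
    ENNReal.toReal_ofReal (Real.exp_pos _).le] at h3
  have h5 : Real.exp (-2) = (Real.exp 1 ^ 2)⁻¹ := by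
    rw [← Real.exp_nat_mul, ← Real.exp_neg]
    norm_num
  rw [div_pow, one_pow, mul_pow, le_div_iff₀ (by positivity)]
  have h6 : Real.exp (-2) * Real.exp 1 ^ 2 = 1 := by
    rw [h5]
    exact inv_mul_cancel₀ (by positivity)
  calc (c.P.card : ℝ) / (q : ℝ) ^ c.n * (Real.exp 1 ^ 2 * ((d : ℝ) + 1) ^ 2)
      = (c.P.card : ℝ) / (q : ℝ) ^ c.n * ((d : ℝ) + 1) ^ 2 * Real.exp 1 ^ 2 := by ring
    _ ≤ Real.exp (-2) * Real.exp 1 ^ 2 := by gcongr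
    _ = 1 := h6

end Translation

end BorelCSP

/-! ### The corollary -/

theorem corollary1p17 {X : Type*} [MeasurableSpace X] [StandardBorelSpace X]
    (q : ℕ) (hq : 0 < q) (𝓑 : BorelCSP.CSP X q) (h𝓑 : 𝓑.IsBorel)
    (h : 𝓑.p * ((𝓑.d : ℝ≥0∞) + 1) ^ 2 ≤ ENNReal.ofReal (Real.exp (-2)))
    (τ : TopologicalSpace X) [PolishSpace X] [BorelSpace X] :
    ∃ f : X → Fin q, 𝓑.IsSolution f ∧ ∀ i : Fin q, BaireMeasurableSet (f ⁻¹' {i}) := by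
  rcases eq_or_ne 𝓑.d ⊤ with hd | hd
  · refine ⟨fun _ => ⟨0, hq⟩, BorelCSP.CSP.isSolution_of_p_eq_zero ?_ _,
      fun i => (measurable_const (measurableSet_singleton i)).baireMeasurableSet⟩
    by_contra hp
    rw [hd] at h
    simp [hp] at h
  · obtain ⟨d, hd⟩ := ENat.ne_top_iff_exists.1 hd
    obtain ⟨ι, hι⟩ := MeasureTheory.exists_measurableEmbedding_real X
    have hcodes := fun c hc => BorelCSP.CSP.card_div_le_of_codes (ι := ι) (c := c) hd.symm h hc
    rcases isEmpty_or_nonempty X with hX | hX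
    -- On an empty space a code would have `n = 0` and probability at least 1, above the bound.
    · refine ⟨isEmptyElim, BorelCSP.CSP.not_violates_of_codes hι.injective fun c hc hP => ?_,
        fun i => MeasurableSet.baireMeasurableSet (by
          rw [Set.eq_empty_of_isEmpty (_ ⁻¹' _)]; exact .empty)⟩
      have hn : c.n = 0 := by
        by_contra hn
        exact isEmptyElim (c.t ⟨0, Nat.pos_of_ne_zero hn⟩)
      have h1 : (1 : ℝ) ≤ c.P.card := by exact_mod_cast Finset.card_pos.2 ⟨_, hP⟩
      have h2 : 1 < Real.exp 1 * ((d : ℝ) + 1) :=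
        one_lt_mul_of_lt_of_le (Real.one_lt_exp_iff.2 one_pos) (by simp)
      have h3 := hcodes c hc
      have h5 : (q : ℝ) ^ c.n = 1 := by rw [hn, pow_zero]
      rw [h5, div_one] at h3
      have h4 : (1 / (Real.exp 1 * ((d : ℝ) + 1))) ^ 2 < 1 :=
        pow_lt_one₀ (by positivity) ((div_lt_one (by positivity)).2 h2) two_ne_zero
      linarith
    -- This θ turns eθ(d+1) ≤ 1 into an equality, and its square is the bound in `hcodes`.
    obtain ⟨f, hf, hfm⟩ := (h𝓑.isBoundedBorel_codes hι.measurable hι.injective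
      hd.symm.le).exists_baireMeasurable_solution hq
      (θ := 1 / (Real.exp 1 * (d + 1))) (by positivity)
      (le_of_eq (by field_simp))
      hcodes
    exact ⟨f, BorelCSP.CSP.not_violates_of_codes hι.injective hf, hfm⟩
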